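/- Let $p>1$ be an integer. A configuration is a map $x:\mathbb Z\to\mathbb Z$, $i\mapsto x_i$. For $n\ge 1$ let $\mathrm{SM}(n)$ be the set of configurations such that $x_i=x_1$ for all $i<1$, $x_n\neq 0$, $x_i=0$ for all $i>n$, and $0\le x_i-x_{i+1}<p$ for all $i\in\mathbb Z$ (so $x$ is monotone and stable). In the one-dimensional Kadanoff sandpile model with parameter $p$, a site $i$ with $x_i-x_{i+1}\ge p$ may topple: then $x_i$ decreases by $p-1$ and each of $x_{i+1},\dots,x_{i+p-1}$ increases by $1$. The avalanche problem $\mathrm{AP}$ is the following decision problem: given $x\in \mathrm{SM}(n)$ and $k$ with $n<k\le n+p-1$, does there exist a finite sequence of topplings, starting from the configuration obtained from $x$ by adding one grain at column $1$, that leads to a configuration with at least one grain in column $k$? An instance $(x,k)$ is given as a binary word by the offset $k-n$ followed by the sequence of height differences $x_1-x_2,\dots,x_{n-1}-x_n,x_n$, where each number $m$ is written as $1^m0$. Theorem. For every fixed integer $p>1$, the problem $\mathrm{AP}$ is in $\mathsf{NC}^1$, that is, the language of the encodings of its positive instances is decided by a logarithmic-space uniform family of Boolean circuits of fan-in at most two,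 of polynomial size and of depth $O(\log N)$, where $N$ is the length of the input. (Logarithmic-space uniform: a description of the circuit for inputs of length $N$ can be computed from $1^N$ by a deterministic Turing machine in work space $O(\log N)$.) -/

import Mathlib

/-! ### The one-dimensional Kadanoff sandpile -/

namespace KSPM

/-- A configuration assigns to every site of `ℤ` its sand content. -/
abbrev Config : Type := ℤ → ℤ

/-- `x` is monotone (non-increasing from left to right). -/
def Monotone (x : Config) : Prop := ∀ i : ℤ, x (i + 1) ≤ x i

/-- `x` is stable for Kadanoff's parameter `p`. -/
def Stable (p : ℕ) (x : Config) : Prop := ∀ i : ℤ, x i - x (i + 1) < p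

/-- Stable monotone configurations `… x₁ x₁ x₁, x₂, …, xₙ, 0 0 0 …` of length `n`: the content is
constant to the left of column `1`, and column `n` is the last one with non-zero content. -/
structure SM (p n : ℕ) (x : Config) : Prop where
  pos : 1 ≤ n
  left : ∀ i : ℤ, i < 1 → x i = x 1
  last : x n ≠ 0
  right : ∀ i : ℤ, (n : ℤ) < i → x i = 0
  monotone : Monotone x
  stable : Stable p x

/-- Add one grain at site `i`. -/
def addGrain (x : Config) (i : ℤ) : Config := Function.update x i (x i + 1)

/-- The result of a toppling at site `i`: it loses `p - 1` grains, and each of the `p - 1` sites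
`i + 1, …, i + p - 1` receives one. -/
def topple (p : ℕ) (x : Config) (i : ℤ) : Config := fun j =>
  if j = i then x j - ((p : ℤ) - 1)
  else if i < j ∧ j ≤ i + (p : ℤ) - 1 then x j + 1
  else x j

/-- One step of the dynamics: some site `i` with `x i - x (i + 1) ≥ p` topples. -/
def Step (p : ℕ) (x y : Config) : Prop :=
  ∃ i : ℤ, (p : ℤ) ≤ x i - x (i + 1) ∧ y = topple p x i

/-- Some sequence of topplings after the addition of a grain at column `1` leads to a
configuration with at least one grain in column `k`. -/
def AvalancheReaches (p : ℕ) (x : Config) (k : ℕ) : Prop :=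
  ∃ y : Config, Relation.ReflTransGen (Step p) (addGrain x 1) y ∧ 1 ≤ y k

/-- The word `1ᵐ0`. -/
def unary (m : ℕ) : List Bool := List.replicate m true ++ [false]

/-- The binary word that encodes the instance `(x, k)`, where `x` has length `n` and `n < k`: the
offset `k - n`, followed by the height differences `x₁ - x₂, …, xₙ₋₁ - xₙ, xₙ - 0`, every number
`m` being written as `1ᵐ0`. -/
def encodeInstance (n : ℕ) (x : Config) (k : ℕ) : List Bool :=
  unary (k - n) ++
    (List.range n).flatMap fun i => unary (x ((i : ℤ) + 1) - x ((i : ℤ) + 2)).toNat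

/-- The avalanche problem `AP` for the parameter `p`, as the language of the encodings of its
positive instances. -/
def AP (p : ℕ) : Language Bool :=
  {w | ∃ (n : ℕ) (x : Config) (k : ℕ), SM p n x ∧ n < k ∧ k ≤ n + p - 1 ∧
    w = encodeInstance n x k ∧ AvalancheReaches p x k}

end KSPM

/-! ### Boolean circuits of bounded fan-in -/

namespace Circ

/-- Gates of fan-in at most two. An `input` gate reads an input bit (numbered from `0`); the
arguments of the other gates are the numbers (from `0`) of earlier gates of the circuit. -/
inductive Gate : Type
  | input (i : ℕ)
  | const (b : Bool)
  | not (j : ℕ)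
  | and (j k : ℕ)
  | or (j k : ℕ)

/-- A circuit is the list of its gates in topological order; the last gate is the output. -/
abbrev Circuit : Type := List Gate

/-- Gate number `m` of a circuit with `n` inputs refers only to existing inputs and to gates with
smaller numbers. -/
def Gate.WellFormed (n m : ℕ) : Gate → Prop
  | .input i => i < n
  | .const _ => True
  | .not j => j < m
  | .and j k => j < m ∧ k < m
  | .or j k => j < m ∧ k < m

/-- `C` is a circuit with `n` inputs and one output. -/
def Circuit.WellFormed (n : ℕ) (C : Circuit) : Prop :=
  C ≠ [] ∧ ∀ (m : ℕ) (h : m < C.length), (C[m]'h).WellFormed n m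

/-- The value of a gate on the input word `x`, from the values `v` of the earlier gates. -/
def Gate.value (x v : List Bool) : Gate → Bool
  | .input i => x.getD i false
  | .const b => b
  | .not j => !(v.getD j false)
  | .and j k => v.getD j false && v.getD k false
  | .or j k => v.getD j false || v.getD k false

/-- The values of all gates. -/
def Circuit.values (x : List Bool) (C : Circuit) : List Bool :=
  C.foldl (fun v g => v ++ [g.value x v]) []

/-- The output of the circuit. -/
def Circuit.eval (x : List Bool) (C : Circuit) : Bool :=
  (Circuit.values x C).getLastD false

/-- The depth of a gate, from the depths `d` of the earlier gates. -/
def Gate.depth (d : List ℕ) : Gate → ℕ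
  | .input _ => 0
  | .const _ => 0
  | .not j => d.getD j 0 + 1
  | .and j k => max (d.getD j 0) (d.getD k 0) + 1
  | .or j k => max (d.getD j 0) (d.getD k 0) + 1

/-- The depths of all gates. -/
def Circuit.depths (C : Circuit) : List ℕ :=
  C.foldl (fun d g => d ++ [g.depth d]) []

/-- The depth of a circuit: the length of a longest path. -/
def Circuit.depth (C : Circuit) : ℕ := (Circuit.depths C).foldr max 0

/-- Binary description of a gate: its kind and its arguments, each number `m` written as `1ᵐ0`. -/
def Gate.encode : Gate → List Bool
  | .input i => KSPM.unary 0 ++ KSPM.unary i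
  | .const b => KSPM.unary 1 ++ KSPM.unary b.toNat
  | .not j => KSPM.unary 2 ++ KSPM.unary j
  | .and j k => KSPM.unary 3 ++ KSPM.unary j ++ KSPM.unary k
  | .or j k => KSPM.unary 4 ++ KSPM.unary j ++ KSPM.unary k

/-- Binary description of a circuit, of length polynomial in its size and number of inputs. -/
def Circuit.encode (C : Circuit) : List Bool := C.flatMap Gate.encode

end Circ

/-! ### Space-bounded Turing machines with output -/

namespace TM

/-- Moves of a head. -/
inductive Move : Type
  | left
  | stay
  | right

/-- Contents of a cell of the input tape: an end marker or a bit of the input. -/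
inductive Cell : Type
  | leftEnd
  | bit (b : Bool)
  | rightEnd

/-- A deterministic Turing machine with a two-way read-only input tape, `tapes` one-way infinite
work tapes and a write-only one-way output tape. From the state, the input cell read and the
symbols read on the work tapes, `δ` gives the new state, the move of the input head, what is
written on each work tape and how its head moves, and the bit (if any) appended to the output; the
machine halts where `δ` is `none`. -/
structure Machine where
  State : Type
  finiteState : Finite State
  Symbol : Type
  finiteSymbol : Finite Symbol
  tapes : ℕ
  start : State
  blank : Symbol
  δ : State → Cell → (Fin tapes → Symbol) →
    Option (State × Move × (Fin tapes → Symbol × Move) × Option Bool)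

/-- Configurations of a machine. -/
structure Machine.Cfg (M : Machine) where
  state : M.State
  inputHead : ℕ
  tape : Fin M.tapes → ℕ → M.Symbol
  head : Fin M.tapes → ℕ
  output : List Bool

/-- New position of a head; a move to the left from cell `0` has no effect. -/
def Move.apply : Move → ℕ → ℕ
  | .left, a => a - 1
  | .stay, a => a
  | .right, a => a + 1

/-- The input `w` is in the cells `1, …, |w|`, between end markers in the cells `0` and
`|w| + 1`. -/
def inputCell (w : List Bool) (a : ℕ) : Cell :=
  if a = 0 then .leftEnd
  else match w[a - 1]? with
    | some b => .bit b
    | none => .rightEnd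

/-- The initial configuration: all heads in cell `0`, all work tapes blank, empty output. -/
def Machine.init (M : Machine) : M.Cfg where
  state := M.start
  inputHead := 0
  tape := fun _ _ => M.blank
  head := fun _ => 0
  output := []

/-- One step on input `w`. The input head does not leave the cells `0, …, |w| + 1`. -/
def Machine.step (M : Machine) (w : List Bool) (c : M.Cfg) : Option M.Cfg :=
  (M.δ c.state (inputCell w c.inputHead) (fun t => c.tape t (c.head t))).map
    fun (q, mv, act, o) =>
      { state := q
        inputHead := min (mv.apply c.inputHead) (w.length + 1)
        tape := fun t => Function.update (c.tape t) (c.head t) (act t).1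
        head := fun t => (act t).2.apply (c.head t)
        output := c.output ++ o.toList }

/-- On input `w`, the machine halts with output `out`, and during the whole computation every work
head stays in the first `s` cells of its tape. -/
def Machine.ComputesInSpace (M : Machine) (w out : List Bool) (s : ℕ) : Prop :=
  (∃ c, StateTransition.Reaches (M.step w) M.init c ∧ M.step w c = none ∧ c.output = out) ∧
    ∀ c, StateTransition.Reaches (M.step w) M.init c → ∀ t, c.head t < s

end TM

/-! ### The class NC¹ -/

/-- The family `C` is logarithmic-space uniform: `1ⁿ ↦ Cₙ` is computed in space `O(log n)`. -/
def LogspaceUniform (C : ℕ → Circ.Circuit) : Prop :=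
  ∃ (M : TM.Machine) (a : ℕ), ∀ n : ℕ,
    M.ComputesInSpace (List.replicate n true) (Circ.Circuit.encode (C n)) (a * Nat.log 2 n + a)

/-- `L` is in (logarithmic-space uniform) NC¹: it is decided by a uniform family of Boolean
circuits of fan-in at most two, of polynomial size and logarithmic depth. -/
def InNC1 (L : Language Bool) : Prop :=
  ∃ C : ℕ → Circ.Circuit,
    (∀ n, (C n).WellFormed n) ∧
    (∀ w : List Bool, w ∈ L ↔ (C w.length).eval w = true) ∧
    (∃ a : ℕ, ∀ n, (C n).length ≤ n ^ a + a) ∧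
    (∃ a : ℕ, ∀ n, (C n).depth ≤ a * Nat.log 2 n + a) ∧
    LogspaceUniform C

/-! ### Avalanches and barriers -/

namespace KSPM

/-! The proof joins two facts: `AP p` is a regular language, and every regular language is in
logarithmic-space uniform NC¹.

Regularity. After one grain is added to a stable configuration, no site topples twice: a fired site
loses `p` from its slope and regains at most `(p - 1) + 1` from its right neighbour and from site `i
+ 1 - p` or the added grain (`Fired.of_stepable`). The final configuration is therefore described by
its set of fired sites, which lies in every set closed under forced topplings and, completed by the
virtual source, is itself such a set. Hence column `k` stays empty iff some closed set, a barrier,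
avoids the sites that feed it (`avalancheReaches_iff`). An avalanche may run back and forth, but the
existence of a barrier can be tested by one nondeterministic scan from left to right: the constraint
at `i` involves only sites from `i + 1 - p` to `i + 1`. The subset construction keeps the possible
contents of the last `p` sites (`mem_windows_append`). Together with the offset and the last
difference this is a right congruence of finite index (`summary_append`), which `isRegular_unary`
transports to the binary encoding.

Circuits. Words act on the states of an automaton by maps, and composition of maps is associative,
so a balanced binary tree of blocks of constant size computes the map of the input in logarithmic
depth (`Computes.value_block`, `depth_circuit`). All blocks have the same length and their positions
are linear in their numbers, so a program with nine counters of linear size prints the circuit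
(`Exec.emitCircuit`). With the counters written in binary on work tapes, this program is a machine
of logarithmic space (`Exec.computesInSpace`). -/

/-- A barrier: a set of sites that contains every site that can topple after the addition of a
grain at column `1`. The added grain is accounted for by a virtual toppling of site `2 - p`. -/
structure IsBarrier (p n : ℕ) (d : ℤ → ℤ) (X : ℤ → Bool) : Prop where
  source : X (2 - p) = true
  left : ∀ i : ℤ, i ≤ 0 → i ≠ 2 - p → X i = false
  closed : ∀ i : ℤ, 1 ≤ i → i ≤ n →
    (p : ℤ) ≤ d i + ((p : ℤ) - 1) * (X (i + 1)).toNat + (X (i + 1 - p)).toNat → X i = true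

/-- `y` is obtained from `x` by adding a grain at column `1` and toppling every site of the set `t`
once, all of these sites being in `X`. -/
structure Fired (p n : ℕ) (x : Config) (X : ℤ → Bool) (y : Config) (t : ℤ → Bool) : Prop where
  supp : ∀ i : ℤ, t i = true → 1 ≤ i ∧ i ≤ n ∧ X i = true
  val : ∀ j : ℤ, y j = x j + (if j = 1 then 1 else 0) - ((p : ℤ) - 1) * (t j).toNat +
    ∑ m ∈ Finset.Ico (j - p + 1) j, ((t m).toNat : ℤ)

/-! ### Topplings confined to a barrier -/

theorem toNat_le_toNat_of_imp {a b : Bool} (h : a = true → b = true) : a.toNat ≤ b.toNat := by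
  cases a <;> cases b <;> simp_all

/-- Consecutive windows of `p - 1` sites differ only by their end points. -/
theorem sum_window_sub (p : ℕ) (hp : 1 < p) (t : ℤ → ℤ) (i : ℤ) :
    ∑ m ∈ Finset.Ico (i - p + 1) i, t m - ∑ m ∈ Finset.Ico (i + 1 - p + 1) (i + 1), t m
      = t (i + 1 - p) - t i := by
  have h1 : Finset.Ico (i - p + 1) i = insert (i + 1 - p) (Finset.Ico (i + 1 - p + 1) i) := by
    ext m; simp only [Finset.mem_Ico, Finset.mem_insert]; omega
  have h2 : Finset.Ico (i + 1 - p + 1) (i + 1) = insert i (Finset.Ico (i + 1 - p + 1) i) := by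
    ext m; simp only [Finset.mem_Ico, Finset.mem_insert]; omega
  rw [h1, h2, Finset.sum_insert (by simp), Finset.sum_insert (by simp)]
  ring

/-- Passing from heights to slopes leaves only the end points of the window sums, so the slope at
`i` sees just the sites `i`, `i + 1` and `i + 1 - p`. This locality is what makes a scan with
bounded memory possible. -/
theorem Fired.slope {p n : ℕ} (hp : 1 < p) {x : Config} {X : ℤ → Bool} {y : Config} {t : ℤ → Bool}
    (h : Fired p n x X y t) (i : ℤ) :
    y i - y (i + 1) = x i - x (i + 1) + (if i = 1 then 1 else 0) - (if i = 0 then 1 else 0)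
      - p * (t i).toNat + ((p : ℤ) - 1) * (t (i + 1)).toNat + (t (i + 1 - p)).toNat := by
  have h0 := sum_window_sub p hp (fun m => ((t m).toNat : ℤ)) i
  rw [h.val i, h.val (i + 1)]
  have h1 : (if i + 1 = 1 then (1 : ℤ) else 0) = if i = 0 then 1 else 0 := by
    congr 1; simp
  rw [h1]
  linarith

/-- The core of the invariant: no site topples twice, and the fired set cannot leave a barrier.
Outside `1, …, n` the slopes are too small for a toppling; inside, the fired neighbours belong to
`X`, so an unstable slope triggers the closure condition of `X`. -/
theorem Fired.of_stepable {p n : ℕ} (hp : 1 < p) {x : Config} {X : ℤ → Bool} {y : Config}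
    {t : ℤ → Bool} (hx : SM p n x) (hX : IsBarrier p n (fun i => x i - x (i + 1)) X)
    (h : Fired p n x X y t) {i : ℤ} (hi : (p : ℤ) ≤ y i - y (i + 1)) :
    t i = false ∧ 1 ≤ i ∧ i ≤ n ∧ X i = true := by
  have hs := h.slope hp i
  rw [hs] at hi
  have hst := hx.stable i
  have hn := hx.pos
  have hp' : (1 : ℤ) < p := by exact_mod_cast hp
  have t1 : (((t (i + 1)).toNat : ℕ) : ℤ) ≤ 1 := by exact_mod_cast Bool.toNat_le _
  have t2 : (((t (i + 1 - p)).toNat : ℕ) : ℤ) ≤ 1 := by exact_mod_cast Bool.toNat_le _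
  have t1' : ((p : ℤ) - 1) * (t (i + 1)).toNat ≤ (p : ℤ) - 1 := by nlinarith
  have hout : ∀ j : ℤ, (j < 1 ∨ (n : ℤ) < j) → t j = false := by
    intro j hj
    by_contra hc
    have := h.supp j (by simpa using hc)
    omega
  have hti : t i = false := by
    by_contra hc
    have hc : t i = true := by simpa using hc
    obtain ⟨h1, h2, -⟩ := h.supp i hc
    rw [hc] at hi
    simp only [Bool.toNat_true, Nat.cast_one, mul_one] at hi
    rw [if_neg (by omega : ¬ i = 0)] at hi
    -- The added grain and a toppling of `i + 1 - p` never count together: for `i = 1` the latter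
    -- site is `2 - p ≤ 0`, where nothing fires.
    by_cases hi1 : i = 1
    · rw [hout (i + 1 - p) (by omega)] at hi
      simp [hi1] at hi hst t1'
      omega
    · rw [if_neg hi1] at hi
      omega
  rw [hti] at hi
  simp only [Bool.toNat_false, Nat.cast_zero, mul_zero] at hi
  have hi1 : 1 ≤ i := by
    by_contra hc
    rw [hout (i + 1 - p) (by omega), if_neg (by omega : ¬ i = 1), hx.left i (by omega)] at hi
    by_cases hi0 : i = 0
    · simp [hi0] at hi t1'
      omega
    · rw [if_neg hi0, hout (i + 1) (by omega), hx.left (i + 1) (by omega)] at hi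
      simp at hi
      omega
  have hin : i ≤ n := by
    by_contra hc
    rw [hout (i + 1) (by omega), hx.right i (by omega), hx.right (i + 1) (by omega),
      if_neg (by omega : ¬ i = 1), if_neg (by omega : ¬ i = 0)] at hi
    simp at hi
    omega
  refine ⟨hti, hi1, hin, hX.closed i hi1 hin ?_⟩
  have m1 : (((t (i + 1)).toNat : ℕ) : ℤ) ≤ (X (i + 1)).toNat := by
    exact_mod_cast toNat_le_toNat_of_imp fun hh => (h.supp _ hh).2.2
  -- The source `2 - p` of `X` pays for the grain added at column `1`.
  have m2 : (if i = 1 then (1 : ℤ) else 0) + (((t (i + 1 - p)).toNat : ℕ) : ℤ)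
      ≤ (X (i + 1 - p)).toNat := by
    by_cases hi1 : i = 1
    · rw [hout (i + 1 - p) (by omega), if_pos hi1]
      have : i + 1 - (p : ℤ) = 2 - p := by omega
      rw [this, hX.source]
      simp
    · rw [if_neg hi1, zero_add]
      exact_mod_cast toNat_le_toNat_of_imp fun hh => (h.supp _ hh).2.2
  have m1' : ((p : ℤ) - 1) * (t (i + 1)).toNat ≤ ((p : ℤ) - 1) * (X (i + 1)).toNat :=
    mul_le_mul_of_nonneg_left m1 (by omega)
  rw [if_neg (by omega : ¬ i = 0)] at hi
  show (p : ℤ) ≤ x i - x (i + 1) + _ + _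
  linarith

theorem Fired.topple {p n : ℕ} {x : Config} {X : ℤ → Bool} {y : Config}
    {t : ℤ → Bool} (h : Fired p n x X y t) {i : ℤ}
    (hi : t i = false ∧ 1 ≤ i ∧ i ≤ n ∧ X i = true) :
    Fired p n x X (topple p y i) (Function.update t i true) := by
  refine ⟨fun j hj => ?_, fun j => ?_⟩
  · by_cases hji : j = i
    · subst hji; exact hi.2
    · rw [Function.update_of_ne hji] at hj; exact h.supp j hj
  · have hsum : ∑ m ∈ Finset.Ico (j - p + 1) j, (((Function.update t i true m).toNat : ℕ) : ℤ)
        = ∑ m ∈ Finset.Ico (j - p + 1) j, ((t m).toNat : ℤ)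
          + if i < j ∧ j ≤ i + p - 1 then 1 else 0 := by
      have : ∀ m, (((Function.update t i true m).toNat : ℕ) : ℤ)
          = ((t m).toNat : ℤ) + if m = i then 1 else 0 := by
        intro m
        by_cases hm : m = i
        · subst hm; simp [hi.1]
        · simp [hm]
      simp only [this, Finset.sum_add_distrib, Finset.sum_ite_eq', Finset.mem_Ico]
      congr 1
      apply if_congr _ rfl rfl
      omega
    rw [hsum]
    unfold KSPM.topple
    by_cases hji : j = i
    · subst hji
      rw [h.val j]
      simp [hi.1]
      ring
    · rw [if_neg hji, Function.update_of_ne hji, h.val j]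
      split_ifs <;> ring

theorem Fired.of_addGrain {p n : ℕ} (x : Config) (X : ℤ → Bool) :
    Fired p n x X (addGrain x 1) fun _ => false := by
  refine ⟨by simp, fun j => ?_⟩
  by_cases hj : j = 1
  · subst hj; simp [addGrain]
  · simp [addGrain, hj]

/-- Induction on the topplings: the next site to topple is unfired and in `X`, so it can be added to
`t`. -/
theorem Fired.of_reaches {p n : ℕ} (hp : 1 < p) {x : Config} {X : ℤ → Bool} (hx : SM p n x)
    (hX : IsBarrier p n (fun i => x i - x (i + 1)) X) {y : Config}
    (hy : Relation.ReflTransGen (Step p) (addGrain x 1) y) : ∃ t, Fired p n x X y t := by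
  induction hy with
  | refl => exact ⟨_, Fired.of_addGrain x X⟩
  | tail _ hstep ih =>
    obtain ⟨t, ht⟩ := ih
    obtain ⟨i, hi, rfl⟩ := hstep
    exact ⟨_, ht.topple (ht.of_stepable hp hx hX hi)⟩

/-- Termination: every toppling removes one site from the unfired ones among `1, …, n`, whose number
is the induction variable `m`. -/
theorem Fired.exists_stable {p n : ℕ} (hp : 1 < p) {x : Config} {X : ℤ → Bool} (hx : SM p n x)
    (hX : IsBarrier p n (fun i => x i - x (i + 1)) X) (m : ℕ) :
    ∀ (y : Config) (t : ℤ → Bool), Relation.ReflTransGen (Step p) (addGrain x 1) y →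
      Fired p n x X y t → ((Finset.Icc (1 : ℤ) n).filter fun i => t i = false).card = m →
      ∃ y' t', Relation.ReflTransGen (Step p) (addGrain x 1) y' ∧ Fired p n x X y' t' ∧
        ∀ i, y' i - y' (i + 1) < p := by
  induction m with
  | zero =>
    intro y t hy ht hm
    refine ⟨y, t, hy, ht, fun i => ?_⟩
    by_contra hc
    obtain ⟨h0, h1, h2, -⟩ := ht.of_stepable hp hx hX (not_lt.1 hc)
    have : i ∈ ((Finset.Icc (1 : ℤ) n).filter fun i => t i = false) := by simp [h0, h1, h2]
    rw [Finset.card_eq_zero] at hm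
    simp [hm] at this
  | succ m ih =>
    intro y t hy ht hm
    by_cases hs : ∀ i, y i - y (i + 1) < p
    · exact ⟨y, t, hy, ht, hs⟩
    push Not at hs
    obtain ⟨i, hi⟩ := hs
    have hs := ht.of_stepable hp hx hX hi
    refine ih _ _ (hy.tail ⟨i, hi, rfl⟩) (ht.topple hs) ?_
    have : ((Finset.Icc (1 : ℤ) n).filter fun j => Function.update t i true j = false)
        = ((Finset.Icc (1 : ℤ) n).filter fun i => t i = false).erase i := by
      ext j
      by_cases hj : j = i
      · subst hj; simp
      · simp [hj]
    rw [this, Finset.card_erase_of_mem (by simp [hs.1, hs.2.1, hs.2.2.1]), hm]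
    rfl

/-- A grain reaches column `k` unless a barrier avoids all the sites that give grains to it. -/
theorem avalancheReaches_iff {p n k : ℕ} (hp : 1 < p) {x : Config} (hx : SM p n x) (hnk : n < k) :
    AvalancheReaches p x k ↔ ¬ ∃ X, IsBarrier p n (fun i => x i - x (i + 1)) X ∧
      X (n + 1) = false ∧ ∀ j : ℤ, (k : ℤ) - p + 1 ≤ j → j ≤ n → X j = false := by
  have hn := hx.pos
  constructor
  · rintro ⟨y, hy, hyk⟩ ⟨X, hX, -, hX0⟩
    obtain ⟨t, ht⟩ := Fired.of_reaches hp hx hX hy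
    have h0 : ∀ m : ℤ, (k : ℤ) - p + 1 ≤ m → t m = false := by
      intro m hm
      by_contra hc
      obtain ⟨-, h2, h3⟩ := ht.supp m (by simpa using hc)
      rw [hX0 m hm h2] at h3
      exact Bool.noConfusion h3
    -- Column `k` is fed only by the `p - 1` sites before it, and none of them fires.
    rw [ht.val, hx.right k (by omega), if_neg (by omega), h0 k (by omega),
      Finset.sum_eq_zero fun m hm => by rw [h0 m (Finset.mem_Ico.1 hm).1]; rfl] at hyk
    simp at hyk
  · intro hno
    -- All sites together form a trivial barrier; it serves only to run the avalanche until it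
    -- stops.
    let X₀ : ℤ → Bool := fun i => decide ((1 ≤ i ∧ i ≤ n) ∨ i = 2 - p)
    have hX₀ : IsBarrier p n (fun i => x i - x (i + 1)) X₀ := by
      refine ⟨by simp [X₀], fun i h1 h2 => ?_, fun i h1 h2 _ => by simp [X₀, h1, h2]⟩
      simp only [X₀, decide_eq_false_iff_not]
      omega
    obtain ⟨y, t, hy, ht, hst⟩ := Fired.exists_stable hp hx hX₀ _ _ _ Relation.ReflTransGen.refl
      (Fired.of_addGrain x X₀) rfl
    refine ⟨y, hy, ?_⟩
    by_contra hyk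
    have hout : ∀ j : ℤ, (j < 1 ∨ (n : ℤ) < j) → t j = false := by
      intro j hj
      by_contra hc
      have := ht.supp j (by simpa using hc)
      omega
    rw [ht.val, hx.right k (by omega), if_neg (by omega), hout k (by omega)] at hyk
    simp only [Bool.toNat_false, Nat.cast_zero, mul_zero, sub_zero, zero_add, not_le] at hyk
    have hzero : ∀ m ∈ Finset.Ico ((k : ℤ) - p + 1) k, ((t m).toNat : ℤ) = 0 := by
      rw [← Finset.sum_eq_zero_iff_of_nonneg fun m _ => by positivity]
      have : 0 ≤ ∑ m ∈ Finset.Ico ((k : ℤ) - p + 1) k, ((t m).toNat : ℤ) :=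
        Finset.sum_nonneg fun m _ => by positivity
      omega
    -- The fired set of the final configuration, with the source added, is a barrier: an unfired
    -- site has slope below `p` after all contributions, so it is not forced.
    refine hno ⟨fun i => t i || decide (i = 2 - p), ⟨by simp, fun i h1 h2 => ?_,
      fun i h1 h2 h3 => ?_⟩, ?_, fun j h1 h2 => ?_⟩
    · simp [hout i (by omega), h2]
    · by_contra hc
      have hti : t i = false := by
        by_contra h; simp at h; simp [h] at hc
      have := hst i
      rw [ht.slope hp i, hti, if_neg (by omega : ¬ i = 0)] at this
      have e1 : decide (i + 1 = 2 - (p : ℤ)) = false := by simp; omega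
      have e2 : (((t (i + 1 - p) || decide (i + 1 - (p : ℤ) = 2 - p)).toNat : ℕ) : ℤ)
          ≤ (if i = 1 then 1 else 0) + ((t (i + 1 - p)).toNat : ℤ) := by
        by_cases hi1 : i = 1
        · subst hi1
          have : ((((t (1 + 1 - p) || decide ((1 : ℤ) + 1 - p = 2 - p)).toNat : ℕ)) : ℤ) ≤ 1 := by
            exact_mod_cast Bool.toNat_le _
          simp only [if_true]
          omega
        · have : decide (i + 1 - (p : ℤ) = 2 - p) = false := by simp; omega
          rw [this]; simp [hi1]
      simp only [e1, Bool.or_false] at h3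
      simp only [Bool.toNat_false, Nat.cast_zero, mul_zero] at this
      linarith
    · simp only [hout (n + 1) (by omega), Bool.false_or, decide_eq_false_iff_not]
      omega
    · have := hzero j (by rw [Finset.mem_Ico]; omega)
      have htj : t j = false := by
        cases h : t j
        · rfl
        · simp [h] at this
      simp only [htj, Bool.false_or, decide_eq_false_iff_not]
      omega

end KSPM


/-! ### The avalanche problem is a regular language -/

/-- A language is regular if membership is invariant under a right congruence of finite index. -/
theorem Language.isRegular_of_congr {α σ : Type} [Finite σ] (L : Language α) (f : List α → σ)
    (hstep : ∀ u v, f u = f v → ∀ a, f (u ++ [a]) = f (v ++ [a]))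
    (hacc : ∀ u v, f u = f v → (u ∈ L ↔ v ∈ L)) : L.IsRegular := by
  apply Language.IsRegular.of_finite_range_leftQuotient
  have key : ∀ u v, f u = f v → L.leftQuotient u = L.leftQuotient v := by
    intro u v huv
    ext y
    rw [Language.mem_leftQuotient, Language.mem_leftQuotient]
    apply hacc
    induction y using List.reverseRecOn with
    | nil => simpa using huv
    | append_singleton y a ih =>
      rw [← List.append_assoc, ← List.append_assoc]
      exact hstep _ _ ih a
  -- Each left quotient equals that of a chosen representative of its class, and there are finitely
  -- many classes.
  have : Set.range L.leftQuotient ⊆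
      Set.range fun s : σ => L.leftQuotient (Function.invFun f s) := by
    rintro _ ⟨u, rfl⟩
    exact ⟨f u, key _ _ (Function.invFun_eq ⟨u, rfl⟩)⟩
  exact (Set.finite_range _).subset this

namespace KSPM

/-! ### Unary words as sequences of numbers below `p` -/

/-- One step of the decoding of a sequence of numbers below `p` written in unary. -/
def decodeStep (p : ℕ) (s : Option (List (Fin p) × Fin p)) (b : Bool) :
    Option (List (Fin p) × Fin p) :=
  s.bind fun q =>
    if b then if h : q.2.val + 1 < p then some (q.1, ⟨q.2.val + 1, h⟩) else none
    else some (q.1 ++ [q.2], ⟨0, q.2.pos⟩)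

/-- Decoding of a word into complete numbers and a last incomplete number. -/
def decode (p : ℕ) (hp : 0 < p) (w : List Bool) : Option (List (Fin p) × Fin p) :=
  w.foldl (decodeStep p) (some ([], ⟨0, hp⟩))

theorem decode_append (p : ℕ) (hp : 0 < p) (w : List Bool) (b : Bool) :
    decode p hp (w ++ [b]) = decodeStep p (decode p hp w) b := by
  simp [decode]

theorem decode_append_replicate (p : ℕ) (hp : 0 < p) (w : List Bool) (l : List (Fin p))
    (h : decode p hp w = some (l, ⟨0, hp⟩)) (c : ℕ) (hc : c < p) :
    decode p hp (w ++ List.replicate c true) = some (l, ⟨c, hc⟩) := by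
  induction c with
  | zero => simpa using h
  | succ c ih =>
    rw [List.replicate_succ', ← List.append_assoc, decode_append, ih (by omega)]
    simp [decodeStep, hc]

theorem decode_flatMap (p : ℕ) (hp : 0 < p) (l : List (Fin p)) :
    decode p hp ((l.map Fin.val).flatMap unary) = some (l, ⟨0, hp⟩) := by
  induction l using List.reverseRecOn with
  | nil => rfl
  | append_singleton l c ih =>
    rw [List.map_append, List.flatMap_append, List.map_singleton, List.flatMap_singleton, unary,
      ← List.append_assoc, decode_append,
      decode_append_replicate p hp _ l ih c c.isLt]
    simp [decodeStep]

/-- With `decode_flatMap`, this makes `decode` an inverse of the encoding; the pending number is the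
final block of ones not yet closed by a zero. -/
theorem eq_of_decode (p : ℕ) (hp : 0 < p) (w : List Bool) : ∀ (l : List (Fin p)) (c : Fin p),
    decode p hp w = some (l, c) → w = ((l.map Fin.val).flatMap unary) ++ List.replicate c true := by
  induction w using List.reverseRecOn with
  | nil =>
    intro l c h
    simp only [decode, List.foldl_nil, Option.some.injEq, Prod.mk.injEq] at h
    simp [← h.1, ← h.2]
  | append_singleton w b ih =>
    intro l c h
    rw [decode_append] at h
    cases hd : decode p hp w with
    | none => simp [hd, decodeStep] at h
    | some q =>
      obtain ⟨l', c'⟩ := q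
      rw [hd] at h
      rw [ih l' c' hd]
      cases b
      · simp only [decodeStep, Option.bind_some, Bool.false_eq_true, if_false,
          Option.some.injEq, Prod.mk.injEq] at h
        rw [← h.1, ← h.2]
        simp [unary]
      · simp only [decodeStep, Option.bind_some, if_true] at h
        split_ifs at h with h'
        simp only [Option.some.injEq, Prod.mk.injEq] at h
        rw [← h.1, ← h.2]
        simp [List.replicate_succ']

/-- Regularity passes from sequences of numbers below `p` to their unary encodings. -/
theorem isRegular_unary {p : ℕ} (hp : 0 < p) {σ : Type} [Finite σ] (f : List (Fin p) → σ)
    (P : List (Fin p) → Prop)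
    (hstep : ∀ u v, f u = f v → ∀ a, f (u ++ [a]) = f (v ++ [a]))
    (hacc : ∀ u v, f u = f v → (P u ↔ P v)) :
    Language.IsRegular ({w | ∃ l : List (Fin p), w = ((l.map Fin.val).flatMap unary) ∧ P l} :
      Language Bool) := by
  -- The class of a word consists of the class of its complete numbers and the count of pending
  -- ones. A block of `p` ones leads to `none`, from which no continuation recovers.
  refine Language.isRegular_of_congr _
    (fun w => (decode p hp w).map fun q => (f q.1, q.2)) ?_ ?_
  · intro u v huv b
    simp only [decode_append] at huv ⊢
    cases hu : decode p hp u with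
    | none =>
      cases hv : decode p hp v with
      | none => rfl
      | some r => simp [hu, hv] at huv
    | some q =>
      cases hv : decode p hp v with
      | none => simp [hu, hv] at huv
      | some r =>
        obtain ⟨l, c⟩ := q
        obtain ⟨l', c'⟩ := r
        simp only [hu, hv, Option.map_some, Option.some.injEq, Prod.mk.injEq] at huv
        obtain ⟨h1, rfl⟩ := huv
        cases b
        · simp [decodeStep, hstep _ _ h1 c]
        · by_cases h : c.val + 1 < p <;> simp [decodeStep, h, h1]
  · have key : ∀ w, w ∈ ({w | ∃ l : List (Fin p), w = ((l.map Fin.val).flatMap unary) ∧ P l} :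
        Language Bool) ↔ ∃ l, decode p hp w = some (l, ⟨0, hp⟩) ∧ P l := by
      intro w
      constructor
      · rintro ⟨l, rfl, hl⟩
        exact ⟨l, decode_flatMap p hp l, hl⟩
      · rintro ⟨l, h, hl⟩
        exact ⟨l, by simpa using eq_of_decode p hp w _ _ h, hl⟩
    have half : ∀ u v, ((decode p hp u).map fun q => (f q.1, q.2))
        = ((decode p hp v).map fun q => (f q.1, q.2)) →
        (∃ l, decode p hp u = some (l, ⟨0, hp⟩) ∧ P l) →
        ∃ l, decode p hp v = some (l, ⟨0, hp⟩) ∧ P l := by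
      rintro u v huv ⟨l, hl, hPl⟩
      rw [hl] at huv
      cases hv : decode p hp v with
      | none => simp [hv] at huv
      | some r =>
        simp only [hv, Option.map_some, Option.some.injEq, Prod.mk.injEq] at huv
        exact ⟨r.1, by rw [huv.2], (hacc _ _ huv.1).1 hPl⟩
    intro u v huv
    refine (key u).trans (Iff.trans ?_ (key v).symm)
    exact ⟨half u v huv, half v u huv.symm⟩

/-! ### Scanning a barrier from left to right -/

/-- The height difference at site `i`. -/
def diffAt (ds : List ℕ) (i : ℤ) : ℤ := (ds.getD (i - 1).toNat 0 : ℕ)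

/-- The possible contents of a barrier for the height differences `ds` at the last `p` sites, up to
the first one after those of `ds`. -/
def windows (p : ℕ) (ds : List ℕ) : Set (Fin p → Bool) :=
  {v | ∃ X, IsBarrier p ds.length (diffAt ds) X ∧
    ∀ j : Fin p, v j = X ((ds.length : ℤ) + 1 - j)}

theorem diffAt_append_of_le (ds : List ℕ) (d : ℕ) {i : ℤ} (h1 : 1 ≤ i) (h : i ≤ ds.length) :
    diffAt (ds ++ [d]) i = diffAt ds i := by
  unfold diffAt
  rw [List.getD_append _ _ _ _ (by omega)]

theorem diffAt_append_last (ds : List ℕ) (d : ℕ) :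
    diffAt (ds ++ [d]) ((ds.length : ℤ) + 1) = d := by
  unfold diffAt
  simp

/-- A new difference adds a single constraint, at site `ds.length + 1`. It involves the next site,
which is the first entry of the new window, and site `ds.length + 2 - p`, the last entry of the old
one; the other entries are shifted. So the new set of windows depends only on the old set and on
`d`. -/
theorem mem_windows_append {p : ℕ} (hp : 1 < p) (ds : List ℕ) (d : ℕ) (v' : Fin p → Bool) :
    v' ∈ windows p (ds ++ [d]) ↔ ∃ v ∈ windows p ds,
      ((p : ℤ) ≤ d + ((p : ℤ) - 1) * (v' ⟨0, by omega⟩).toNat + (v ⟨p - 1, by omega⟩).toNat →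
        v ⟨0, by omega⟩ = true) ∧
      ∀ (j : ℕ) (h : j + 1 < p), v' ⟨j + 1, h⟩ = v ⟨j, by omega⟩ := by
  have hp' : (1 : ℤ) < p := by exact_mod_cast hp
  constructor
  · rintro ⟨X, hX, hv'⟩
    refine ⟨fun j => X ((ds.length : ℤ) + 1 - j), ⟨X, ⟨hX.source, hX.left, fun i h1 h2 h3 => ?_⟩,
      fun _ => rfl⟩, fun h => ?_, fun j h => ?_⟩
    · refine hX.closed i h1 (by simp; omega) ?_
      rwa [diffAt_append_of_le ds d h1 h2]
    · simp only [Nat.cast_zero, sub_zero]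
      refine hX.closed _ (by omega) (by simp) ?_
      rw [diffAt_append_last]
      convert h using 4
      · rw [hv']; simp
      · congr 1; push_cast [Nat.cast_sub hp.le]; ring
    · rw [hv']
      congr 1
      simp only [List.length_append, List.length_singleton]
      push_cast
      ring
  · rintro ⟨v, ⟨X, hX, hv⟩, hc, hsh⟩
    -- The conditions on `X` for `ds` stop at site `ds.length + 1`, so the value at the next site is
    -- free.
    have hne : ∀ i : ℤ, i ≤ ds.length + 1 →
        Function.update X ((ds.length : ℤ) + 2) (v' ⟨0, by omega⟩) i = X i :=
      fun i hi => Function.update_of_ne (by omega) _ _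
    refine ⟨Function.update X ((ds.length : ℤ) + 2) (v' ⟨0, by omega⟩), ⟨?_, fun i h1 h2 => ?_,
      fun i h1 h2 h3 => ?_⟩, fun j => ?_⟩
    · rw [hne _ (by omega)]; exact hX.source
    · rw [hne _ (by omega)]; exact hX.left i h1 h2
    · simp only [List.length_append, List.length_singleton] at h2
      push_cast at h2
      rw [hne i h2]
      rw [hne (i + 1 - p) (by omega)] at h3
      by_cases hi : i ≤ ds.length
      · rw [hne (i + 1) (by omega), diffAt_append_of_le ds d h1 hi] at h3
        exact hX.closed i h1 hi h3
      · obtain rfl : i = (ds.length : ℤ) + 1 := by omega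
        have e0 := hv ⟨0, by omega⟩
        simp only [Nat.cast_zero, sub_zero] at e0
        rw [← e0]
        apply hc
        rw [diffAt_append_last] at h3
        convert h3 using 4
        · have : (ds.length : ℤ) + 1 + 1 = (ds.length : ℤ) + 2 := by ring
          rw [this, Function.update_self]
        · rw [hv]; congr 1; push_cast [Nat.cast_sub hp.le]; ring
    · obtain ⟨j, hj⟩ := j
      cases j with
      | zero =>
        have : (((ds ++ [d]).length : ℕ) : ℤ) + 1 - ((0 : ℕ) : ℤ) = (ds.length : ℤ) + 2 := by
          simp only [List.length_append, List.length_singleton]; push_cast; ring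
        simp only [this, Function.update_self]
      | succ j =>
        rw [hsh j hj, hv, hne _ (by simp)]
        congr 1
        simp only [List.length_append, List.length_singleton]
        push_cast
        ring

/-- The avalanche reaches the column at distance `o` after the last site. -/
def Positive (p : ℕ) (o : ℕ) (W : Set (Fin p → Bool)) : Prop :=
  ¬ ∃ v ∈ W, ∀ j : Fin p, j + o ≤ p → v j = false

/-- Entry `j` of a window is site `n + 1 - j`; for `j ≥ 1` it feeds column `n + o` exactly when `j +
o ≤ p`. Entry `0` is the site `n + 1` past the end. -/
theorem avalancheReaches_iff_positive {p n o : ℕ} (hp : 1 < p) {x : Config} (hx : SM p n x)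
    (ho : 1 ≤ o) (hop : o < p) (ds : List ℕ) (hlen : ds.length = n)
    (hds : ∀ i : ℤ, 1 ≤ i → i ≤ n → diffAt ds i = x i - x (i + 1)) :
    AvalancheReaches p x (n + o) ↔ Positive p o (windows p ds) := by
  rw [avalancheReaches_iff hp hx (by omega), Positive, not_iff_not]
  subst hlen
  constructor
  · rintro ⟨X, hX, h0, h1⟩
    refine ⟨fun j => X ((ds.length : ℤ) + 1 - j), ⟨X, ⟨hX.source, hX.left, fun i a b c => ?_⟩,
      fun _ => rfl⟩, fun j hj => ?_⟩
    · refine hX.closed i a b ?_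
      rwa [hds i a b] at c
    · by_cases hj0 : j.val = 0
      · simp [hj0, h0]
      · exact h1 _ (by push_cast; omega) (by omega)
  · rintro ⟨v, ⟨X, hX, hv⟩, hz⟩
    refine ⟨X, ⟨hX.source, hX.left, fun i a b c => ?_⟩, ?_, fun j a b => ?_⟩
    · refine hX.closed i a b ?_
      rwa [hds i a b]
    · have := hz ⟨0, by omega⟩ (by simp; omega)
      rw [hv] at this
      simpa using this
    · push_cast at a
      have := hz ⟨((ds.length : ℤ) + 1 - j).toNat, by omega⟩ (by simp; omega)
      rw [hv] at this
      convert this using 2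
      simp
      omega

/-! ### Instances as lists of numbers below `p` -/

/-- The finite summary of a sequence of numbers that decides whether it encodes a positive
instance. -/
def summary (p : ℕ) : List (Fin p) → Option (Fin p × Set (Fin p → Bool) × Option (Fin p))
  | [] => none
  | o :: ds => some (o, windows p (ds.map Fin.val), ds.getLast?)

/-- The acceptance condition on summaries. -/
def Accepts (p : ℕ) (s : Option (Fin p × Set (Fin p → Bool) × Option (Fin p))) : Prop :=
  ∃ o W e, s = some (o, W, some e) ∧ 1 ≤ o.val ∧ 1 ≤ e.val ∧ Positive p o W

/-- The offset comes first and is kept, the last number is overwritten, and the set of windows is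
updated from itself by `mem_windows_append`. -/
theorem summary_append {p : ℕ} (hp : 1 < p) (u v : List (Fin p)) (h : summary p u = summary p v)
    (a : Fin p) : summary p (u ++ [a]) = summary p (v ++ [a]) := by
  cases u with
  | nil =>
    cases v with
    | nil => rfl
    | cons o ds => simp [summary] at h
  | cons o ds =>
    cases v with
    | nil => simp [summary] at h
    | cons o' ds' =>
      simp only [summary, Option.some.injEq, Prod.mk.injEq] at h
      simp only [summary, List.cons_append, Option.some.injEq, Prod.mk.injEq,
        List.getLast?_append, List.map_append, List.map_cons, List.map_nil]
      refine ⟨h.1, ?_, by simp⟩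
      ext w
      rw [mem_windows_append hp, mem_windows_append hp, h.2.1]

theorem encodeInstance_eq (n : ℕ) (x : Config) (k : ℕ) :
    encodeInstance n x k = unary (k - n) ++ ((List.range n).map fun i : ℕ =>
      (x ((i : ℤ) + 1) - x ((i : ℤ) + 2)).toNat).flatMap unary := by
  simp [encodeInstance, List.flatMap_map, List.flatMap_assoc]

/-- A configuration is equivalent to its list of slopes: monotonicity and stability place them in
`Fin p`, and the last slope is the content of column `n`, hence the condition that it be non-zero.
-/
theorem AP_eq {p : ℕ} (hp : 1 < p) :
    AP p = {w | ∃ l : List (Fin p), w = ((l.map Fin.val).flatMap unary) ∧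
      Accepts p (summary p l)} := by
  ext w
  constructor
  · rintro ⟨n, x, k, hx, hnk, hk, rfl, hreach⟩
    have hn := hx.pos
    have hlt : ∀ i : ℕ, (x ((i : ℤ) + 1) - x ((i : ℤ) + 2)).toNat < p := by
      intro i
      have := hx.stable ((i : ℤ) + 1)
      rw [show (i : ℤ) + 1 + 1 = (i : ℤ) + 2 by ring] at this
      omega
    let ds : List (Fin p) := (List.range n).map fun i => ⟨_, hlt i⟩
    have hlast : ds.getLast? = some ⟨_, hlt (n - 1)⟩ := by
      simp [ds, List.getLast?_range, Nat.pos_iff_ne_zero.1 hx.pos]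
    refine ⟨⟨k - n, by omega⟩ :: ds, ?_, ⟨_, _, _, by rw [summary, hlast], ?_, ?_, ?_⟩⟩
    · simp [encodeInstance_eq, ds, List.flatMap_cons, Function.comp_def]
    · simp; omega
    · have h1 := hx.monotone n
      have h2 := hx.right (n + 1) (by omega)
      have h3 := hx.last
      rw [h2] at h1
      have e1 : ((n - 1 : ℕ) : ℤ) + 1 = n := by omega
      have e2 : ((n - 1 : ℕ) : ℤ) + 2 = n + 1 := by omega
      simp only [e1, e2, h2]
      omega
    · rw [← avalancheReaches_iff_positive hp hx (by simp; omega) (by simp; omega)]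
      · rwa [Nat.add_sub_cancel' hnk.le]
      · simp [ds]
      · intro i h1 h2
        have : (i - 1).toNat < n := by omega
        simp only [diffAt, ds, List.map_map]
        rw [List.getD_eq_getElem _ _ (by simp; omega)]
        simp only [List.getElem_map, List.getElem_range, Function.comp_apply]
        have e1 : (((i - 1).toNat : ℕ) : ℤ) + 1 = i := by omega
        have e2 : (((i - 1).toNat : ℕ) : ℤ) + 2 = i + 1 := by omega
        rw [e1, e2]
        have := hx.monotone i
        omega
  · rintro ⟨l, rfl, o, W, e, hl, ho, he, hpos⟩
    cases l with
    | nil => simp [summary] at hl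
    | cons o' ds =>
      simp only [summary, Option.some.injEq, Prod.mk.injEq] at hl
      obtain ⟨rfl, rfl, hlast⟩ := hl
      -- Heights are suffix sums of the differences. The truncation `toNat` makes the content
      -- constant to the left of column `1`, and past the end the sum is empty.
      let x : Config := fun i => (((ds.map Fin.val).drop (i - 1).toNat).sum : ℕ)
      have hne : ds ≠ [] := by rintro rfl; simp at hlast
      have hn : 1 ≤ ds.length := List.length_pos_iff.2 hne
      have hdiff : ∀ i : ℤ, 1 ≤ i → x i - x (i + 1) = diffAt (ds.map Fin.val) i := by
        intro i hi
        simp only [x, diffAt]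
        rw [show (i + 1 - 1).toNat = (i - 1).toNat + 1 by omega]
        by_cases h : (i - 1).toNat < (ds.map Fin.val).length
        · rw [List.drop_eq_getElem_cons h, List.getD_eq_getElem _ _ h]
          simp
        · rw [List.drop_eq_nil_of_le (by omega), List.drop_eq_nil_of_le (by omega),
            List.getD_eq_default _ _ (by omega)]
          simp
      have hdlt : ∀ i : ℤ, 0 ≤ diffAt (ds.map Fin.val) i ∧ diffAt (ds.map Fin.val) i < p := by
        intro i
        refine ⟨by simp [diffAt], ?_⟩
        unfold diffAt
        by_cases h : (i - 1).toNat < (ds.map Fin.val).length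
        · rw [List.getD_eq_getElem _ _ h]
          simp
        · rw [List.getD_eq_default _ _ (by omega)]
          simp; omega
      have hleft : ∀ i : ℤ, i < 1 → x i = x 1 := by
        intro i hi
        simp only [x]
        rw [show (i - 1).toNat = (1 - 1 : ℤ).toNat by omega]
      have hright : ∀ i : ℤ, (ds.length : ℤ) < i → x i = 0 := by
        intro i hi
        simp only [x]
        rw [List.drop_eq_nil_of_le (by simp; omega)]
        simp
      have hx : SM p ds.length x := by
        refine ⟨hn, hleft, ?_, hright, fun i => ?_, fun i => ?_⟩
        · have h1 := hdiff ds.length (by omega)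
          rw [hright (ds.length + 1) (by omega)] at h1
          have h2 : diffAt (ds.map Fin.val) ds.length = e.val := by
            rw [List.getLast?_eq_getElem?] at hlast
            have e1 : ((ds.length : ℤ) - 1).toNat = ds.length - 1 := by omega
            rw [diffAt, List.getD_eq_getElem?_getD, e1, List.getElem?_map, hlast]
            simp
          omega
        · by_cases hi : 1 ≤ i
          · have := hdiff i hi
            have := hdlt i
            omega
          · rw [hleft i (by omega)]
            by_cases h0 : i = 0
            · simp [h0]
            · rw [hleft (i + 1) (by omega)]
        · by_cases hi : 1 ≤ i
          · have := hdiff i hi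
            have := hdlt i
            omega
          · rw [hleft i (by omega)]
            by_cases h0 : i = 0
            · simp [h0]; omega
            · rw [hleft (i + 1) (by omega)]; simp; omega
      have ho' := o'.isLt
      refine ⟨ds.length, x, ds.length + o', hx, by omega, by omega, ?_, ?_⟩
      · rw [encodeInstance_eq, List.map_cons, List.flatMap_cons, Nat.add_sub_cancel_left]
        congr 2
        have : ds.map Fin.val = (List.range ds.length).map fun i : ℕ =>
            (x ((i : ℤ) + 1) - x ((i : ℤ) + 2)).toNat := by
          apply List.ext_getElem (by simp)
          intro i h1 h2
          simp only [List.getElem_map, List.getElem_range]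
          have := hdiff ((i : ℤ) + 1) (by omega)
          rw [show (i : ℤ) + 1 + 1 = (i : ℤ) + 2 by ring] at this
          rw [this, diffAt, show ((i : ℤ) + 1 - 1).toNat = i by omega,
            List.getD_eq_getElem _ _ h1]
          simp
        exact this
      · rw [avalancheReaches_iff_positive hp hx ho o'.isLt (ds.map Fin.val) (by simp)
          fun i h1 _ => (hdiff i h1).symm]
        exact hpos

theorem AP_isRegular {p : ℕ} (hp : 1 < p) : (AP p).IsRegular := by
  rw [AP_eq hp]
  exact isRegular_unary (by omega) (summary p) _ (summary_append hp)
    fun u v h => by rw [h]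

end KSPM


/-! ### Register programs and their simulation by space-bounded Turing machines -/

namespace TM

/-- Programs over `k` registers holding natural numbers. `loop r P` runs `P` as long as register `r`
is non-zero, decrementing it before each run, and `load r` adds to register `r` the number of the
input cells that are not yet read. -/
inductive Prog (k : ℕ) : Type
  | skip
  | inc (r : Fin k)
  | pred (r : Fin k)
  | emit (b : Bool)
  | seq (P Q : Prog k)
  | loop (r : Fin k) (P : Prog k)
  | load (r : Fin k)

/-- Big-step semantics of programs without `load`: final registers and output, all registers
being at most `B`. -/
inductive Exec {k : ℕ} (B : ℕ) : Prog k → (Fin k → ℕ) → (Fin k → ℕ) → List Bool → Prop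
  | skip (ρ) : Exec B .skip ρ ρ []
  | inc (r ρ) : ρ r + 1 ≤ B → Exec B (.inc r) ρ (Function.update ρ r (ρ r + 1)) []
  | pred (r ρ) : Exec B (.pred r) ρ (Function.update ρ r (ρ r - 1)) []
  | emit (b ρ) : Exec B (.emit b) ρ ρ [b]
  | seq {P Q ρ ρ' ρ'' o o'} : Exec B P ρ ρ' o → Exec B Q ρ' ρ'' o' →
      Exec B (.seq P Q) ρ ρ'' (o ++ o')
  | loop_zero {r P ρ} : ρ r = 0 → Exec B (.loop r P) ρ ρ []
  | loop_succ {r P ρ ρ' ρ'' o o'} : ρ r ≠ 0 → Exec B P (Function.update ρ r (ρ r - 1)) ρ' o →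
      Exec B (.loop r P) ρ' ρ'' o' → Exec B (.loop r P) ρ ρ'' (o ++ o')

/-! ### The machine of a program -/

/-- Symbols of the work tapes: blank, end marker, or a binary digit. -/
abbrev Sym : Type := Option (Option Bool)

/-- What the head of the tape of a register is doing. -/
inductive Kind : Type
  | up
  | down
  | undo
  | back

instance : Finite Kind :=
  Finite.of_injective (β := Fin 4)
    (fun | .up => 0 | .down => 1 | .undo => 2 | .back => 3)
    (by intro a b; cases a <;> cases b <;> simp)

variable {k : ℕ}

/-- The continuation after a successful decrement. -/
def afterDecrement : List (Prog k) → List (Prog k)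
  | .pred _ :: l => l
  | .loop r P :: l => P :: .loop r P :: l
  | l => l

/-- The lists of programs that can remain to be run when `P` is run before `l`. -/
def continuations : Prog k → List (Prog k) → Set (List (Prog k))
  | .seq P Q, l => {.seq P Q :: l} ∪ continuations P (Q :: l) ∪ continuations Q l
  | .loop r P, l => {.loop r P :: l, l} ∪ continuations P (.loop r P :: l)
  | .load r, l => {.load r :: l, .inc r :: .load r :: l, l}
  | P, l => {P :: l, l}

/-- Continuations come from the text of the program alone, not from register contents; their
finiteness lets them serve as machine states. -/
theorem finite_continuations (P : Prog k) (l : List (Prog k)) : (continuations P l).Finite := by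
  induction P generalizing l with
  | seq P Q ihP ihQ => exact ((Set.finite_singleton _).union (ihP _)).union (ihQ _)
  | loop r P ih => exact (Set.toFinite _).union (ih _)
  | _ => simp [continuations]

theorem cons_mem_continuations (P : Prog k) (l : List (Prog k)) : P :: l ∈ continuations P l := by
  cases P <;> simp [continuations]

theorem mem_continuations (P : Prog k) (l : List (Prog k)) : l ∈ continuations P l := by
  induction P generalizing l <;> simp [continuations, *]

/-- The action on the work tape of a register in the course of an operation on it. -/
def micro (l : List (Prog k)) : Kind → Sym → (List (Prog k) × Option Kind) × Sym × Move
  | .up, some (some true) => ((l, some .up), some (some false), .right)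
  | .up, _ => ((l, some .back), some (some true), .left)
  | .down, some (some false) => ((l, some .down), some (some true), .right)
  | .down, some (some true) => ((afterDecrement l, some .back), some (some false), .left)
  | .down, s => ((l, some .undo), s, .left)
  | .undo, some (some _) => ((l, some .undo), some (some false), .left)
  | .undo, s => ((l.tail, none), s, .stay)
  | .back, some (some b) => ((l, some .back), some (some b), .left)
  | .back, s => ((l, none), s, .stay)

/-- Start an operation on register `r`: leave a marker in cell `0` and move to the right. -/
def startAction (r : Fin k) (syms : Fin k → Sym) : Fin k → Sym × Move :=
  fun t => if t = r then (some none, .right) else (syms t, .stay)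

/-- The action that changes nothing on the work tapes. -/
def idle (syms : Fin k → Sym) : Fin k → Sym × Move := fun t => (syms t, .stay)

/-- The transition when all heads are in cell `0`. -/
def dispatch (cell : Cell) (syms : Fin k → Sym) : List (Prog k) →
    Option ((List (Prog k) × Option (Kind × Fin k)) × Move × (Fin k → Sym × Move) × Option Bool)
  | [] => none
  | .skip :: l => some ((l, none), .stay, idle syms, none)
  | .inc r :: l => some ((l, some (.up, r)), .stay, startAction r syms, none)
  | .pred r :: l => some ((.pred r :: l, some (.down, r)), .stay, startAction r syms, none)
  | .emit b :: l => some ((l, none), .stay, idle syms, some b)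
  | .seq P Q :: l => some ((P :: Q :: l, none), .stay, idle syms, none)
  | .loop r P :: l => some ((.loop r P :: l, some (.down, r)), .stay, startAction r syms, none)
  | .load r :: l => match cell with
    | .rightEnd => some ((l, none), .stay, idle syms, none)
    | _ => some ((.inc r :: .load r :: l, none), .right, idle syms, none)

/-- The full transition function on continuations. -/
def transition (q : List (Prog k) × Option (Kind × Fin k)) (cell : Cell) (syms : Fin k → Sym) :
    Option ((List (Prog k) × Option (Kind × Fin k)) × Move × (Fin k → Sym × Move) × Option Bool) :=
  match q.2 with
  | none => dispatch cell syms q.1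
  | some (κ, r) =>
    let m := micro q.1 κ (syms r)
    some ((m.1.1, m.1.2.map fun κ' => (κ', r)), .stay,
      fun t => if t = r then m.2 else (syms t, .stay), none)

/-- A continuation as an element of the finite set of those that occur for `P`. -/
noncomputable def clip (P : Prog k) (l : List (Prog k)) : {l // l ∈ continuations P []} := by
  classical
  exact if h : l ∈ continuations P [] then ⟨l, h⟩ else ⟨[], mem_continuations P []⟩

theorem clip_val {P : Prog k} {l : List (Prog k)} (h : l ∈ continuations P []) :
    (clip P l).val = l := by
  simp [clip, h]

/-- The Turing machine that runs a program: the content of each register is written in binary,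
least significant digit first, from cell `1` on of a work tape of its own. -/
noncomputable def Prog.machine (P : Prog k) : Machine where
  State := {l // l ∈ continuations P []} × Option (Kind × Fin k)
  finiteState := by
    have := (finite_continuations P []).to_subtype
    infer_instance
  Symbol := Sym
  finiteSymbol := inferInstance
  tapes := k
  start := (clip P [P], none)
  blank := none
  δ := fun q cell syms => (transition (q.1.val, q.2) cell syms).map fun a =>
    ((clip P a.1.1, a.1.2), a.2)

/-- Configurations of the machine of a program. -/
noncomputable def conf (P : Prog k) (l : List (Prog k)) (ph : Option (Kind × Fin k)) (ih : ℕ)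
    (T : Fin k → ℕ → Sym) (hd : Fin k → ℕ) (out : List Bool) : P.machine.Cfg where
  state := (clip P l, ph)
  inputHead := ih
  tape := T
  head := hd
  output := out

/-! ### Runs in bounded space -/

/-- A sequence of steps in which all work heads stay in the first `s` cells, except possibly in the
last configuration. -/
def Machine.RunIn (M : Machine) (w : List Bool) (s : ℕ) : M.Cfg → M.Cfg → Prop :=
  Relation.ReflTransGen fun c c' => (∀ t, c.head t < s) ∧ M.step w c = some c'

theorem Machine.RunIn.reaches {M : Machine} {w : List Bool} {s : ℕ} {c c' : M.Cfg}
    (h : M.RunIn w s c c') : StateTransition.Reaches (M.step w) c c' := by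
  induction h with
  | refl => exact Relation.ReflTransGen.refl
  | tail _ h ih => exact ih.tail h.2

/-- The machine is deterministic, so a halting run passes through every reachable configuration. -/
theorem Machine.RunIn.bound {M : Machine} {w : List Bool} {s : ℕ} {c c' : M.Cfg}
    (h : M.RunIn w s c c') (hc' : ∀ t, c'.head t < s) (hhalt : M.step w c' = none) :
    ∀ b, StateTransition.Reaches (M.step w) c b → ∀ t, b.head t < s := by
  induction h using Relation.ReflTransGen.head_induction_on with
  | refl =>
    intro b hb
    rcases Relation.ReflTransGen.cases_head hb with rfl | ⟨d, hd, -⟩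
    · exact hc'
    · rw [hhalt] at hd; simp at hd
  | head hstep _ ih =>
    intro b hb
    rcases Relation.ReflTransGen.cases_head hb with rfl | ⟨d, hd, hdb⟩
    · exact hstep.1
    · rw [hstep.2] at hd
      rw [Option.mem_def, Option.some.injEq] at hd
      subst hd
      exact ih b hdb

/-! ### Tapes and binary counters -/

/-- The tape with `c` in cell `0`, followed by the digits `u`. -/
def tapeOf (c : Sym) (u : List Bool) : ℕ → Sym
  | 0 => c
  | i + 1 => u[i]?.map some

theorem tapeOf_length (c : Sym) (u v : List Bool) (b : Bool) :
    tapeOf c (u ++ b :: v) (u.length + 1) = some (some b) := by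
  simp [tapeOf]

theorem tapeOf_length_self (c : Sym) (u : List Bool) :
    tapeOf c u (u.length + 1) = none := by
  simp [tapeOf]

theorem tapeOf_nil : tapeOf none [] = fun _ => none := by
  funext i; cases i <;> simp [tapeOf]

theorem update_tapeOf (c : Sym) (u v : List Bool) (b b' : Bool) :
    Function.update (tapeOf c (u ++ b :: v)) (u.length + 1) (some (some b'))
      = tapeOf c (u ++ b' :: v) := by
  funext i
  cases i with
  | zero => simp [tapeOf]
  | succ i =>
    by_cases h : i = u.length
    · subst h; simp [tapeOf]
    · rw [Function.update_of_ne (by omega)]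
      simp only [tapeOf]
      congr 1
      simp only [List.getElem?_append, List.getElem?_cons]
      by_cases h1 : i < u.length
      · simp [h1]
      · have : i - u.length ≠ 0 := by omega
        simp [this]

theorem update_tapeOf_end (c : Sym) (u : List Bool) (b : Bool) :
    Function.update (tapeOf c u) (u.length + 1) (some (some b)) = tapeOf c (u ++ [b]) := by
  funext i
  cases i with
  | zero => simp [tapeOf]
  | succ i =>
    by_cases h : i = u.length
    · subst h; simp [tapeOf]
    · rw [Function.update_of_ne (by omega)]
      simp only [tapeOf]
      congr 1
      simp only [List.getElem?_append]
      by_cases h1 : i < u.length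
      · simp [h1]
      · simp only [h1, if_false]
        rw [List.getElem?_eq_none (by omega), List.getElem?_eq_none (by simp; omega)]

theorem update_tapeOf_zero (c c' : Sym) (u : List Bool) :
    Function.update (tapeOf c u) 0 c' = tapeOf c' u := by
  funext i; cases i <;> simp [tapeOf]

/-- The number with the given binary digits, least significant digit first. -/
def binVal : List Bool → ℕ
  | [] => 0
  | b :: u => b.toNat + 2 * binVal u

/-- Increment of a binary number. -/
def binInc : List Bool → List Bool
  | [] => [true]
  | false :: u => true :: u
  | true :: u => false :: binInc u

/-- Decrement of a binary number, if it is not zero. -/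
def binDec : List Bool → Option (List Bool)
  | [] => none
  | true :: u => some (false :: u)
  | false :: u => (binDec u).map (true :: ·)

theorem binVal_binInc (u : List Bool) : binVal (binInc u) = binVal u + 1 := by
  induction u with
  | nil => simp [binInc, binVal]
  | cons b u ih => cases b <;> simp [binInc, binVal, ih] <;> ring

/-- A digit is added only when all digits are ones, so that the new value is `2 ^ u.length`. This
bounds the length by the values reached, although leading zeros are never removed. -/
theorem length_binInc (u : List Bool) :
    (binInc u).length = u.length ∨
      (binInc u).length = u.length + 1 ∧ binVal u + 1 = 2 ^ u.length := by
  induction u with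
  | nil => simp [binInc, binVal]
  | cons b u ih =>
    cases b
    · simp [binInc]
    · rcases ih with h | ⟨h, h'⟩
      · simp [binInc, h]
      · right
        simp only [binInc, List.length_cons, h, binVal, Bool.toNat_true, true_and]
        rw [pow_succ, ← h']; ring

theorem binVal_binDec {u v : List Bool} (h : binDec u = some v) :
    binVal u = binVal v + 1 ∧ v.length = u.length := by
  induction u generalizing v with
  | nil => simp [binDec] at h
  | cons b u ih =>
    cases b
    · simp only [binDec, Option.map_eq_some_iff] at h
      obtain ⟨v', hv', rfl⟩ := h
      have := ih hv'
      simp [binVal, this.1, this.2]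
      omega
    · simp only [binDec, Option.some.injEq] at h
      subst h
      simp [binVal]; omega

theorem binVal_eq_zero {u : List Bool} (h : binDec u = none) : binVal u = 0 := by
  induction u with
  | nil => rfl
  | cons b u ih =>
    cases b
    · simp only [binDec, Option.map_eq_none_iff] at h
      simp [binVal, ih h]
    · simp [binDec] at h

theorem binVal_replicate_false (m : ℕ) : binVal (List.replicate m false) = 0 := by
  induction m with
  | zero => rfl
  | succ m ih => simp [List.replicate_succ, binVal, ih]

/-! ### Correctness of the simulation -/

section Simulation

variable {P : Prog k} {w : List Bool} {s : ℕ}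

theorem Move.apply_stay (a : ℕ) : Move.stay.apply a = a := rfl

theorem Move.apply_right (a : ℕ) : Move.right.apply a = a + 1 := rfl

theorem step_micro (l : List (Prog k)) (hl : l ∈ continuations P []) (κ : Kind) (r : Fin k)
    (ih : ℕ) (hih : ih ≤ w.length + 1) (T : Fin k → ℕ → Sym) (σ : ℕ → Sym) (h : ℕ)
    (out : List Bool) :
    P.machine.step w (conf P l (some (κ, r)) ih (Function.update T r σ)
        (Function.update (fun _ => 0) r h) out)
      = some (conf P (micro l κ (σ h)).1.1 ((micro l κ (σ h)).1.2.map fun κ' => (κ', r)) ih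
          (Function.update T r (Function.update σ h (micro l κ (σ h)).2.1))
          (Function.update (fun _ => 0) r ((micro l κ (σ h)).2.2.apply h)) out) := by
  simp only [Machine.step, Prog.machine, conf, transition, clip_val hl, Option.map_some,
    Function.update_self, Option.toList_none, List.append_nil, Move.apply_stay, min_eq_left hih,
    Option.some.injEq, Machine.Cfg.mk.injEq, true_and, and_true]
  constructor
  · funext t
    by_cases ht : t = r
    · subst ht; simp
    · simp [ht]
  · funext t
    by_cases ht : t = r
    · subst ht; simp
    · simp [ht, Move.apply_stay]

theorem run_micro {l : List (Prog k)} (hl : l ∈ continuations P []) {κ : Kind} {r : Fin k}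
    {ih : ℕ} (hih : ih ≤ w.length + 1) (T : Fin k → ℕ → Sym) {σ : ℕ → Sym} {h : ℕ}
    (hs : h < s) (out : List Bool) {c : P.machine.Cfg}
    (hrun : P.machine.RunIn w s
      (conf P (micro l κ (σ h)).1.1 ((micro l κ (σ h)).1.2.map fun κ' => (κ', r)) ih
          (Function.update T r (Function.update σ h (micro l κ (σ h)).2.1))
          (Function.update (fun _ => 0) r ((micro l κ (σ h)).2.2.apply h)) out) c) :
    P.machine.RunIn w s (conf P l (some (κ, r)) ih (Function.update T r σ)
        (Function.update (fun _ => 0) r h) out) c := by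
  refine Relation.ReflTransGen.head ⟨fun t => ?_, step_micro l hl κ r ih hih T σ h out⟩ hrun
  have hall : ∀ t : Fin k, Function.update (fun _ => 0) r h t < s := by
    intro t
    rw [Function.update_apply]
    split_ifs <;> omega
  exact hall t

/-- The marker in cell `0` stops the head; the digits are rewritten unchanged. -/
theorem run_back {l : List (Prog k)} (hl : l ∈ continuations P []) (r : Fin k)
    {ih : ℕ} (hih : ih ≤ w.length + 1) (T : Fin k → ℕ → Sym) (u : List Bool) (out : List Bool)
    (h : ℕ) (hu : h ≤ u.length) (hs : h < s) :
    P.machine.RunIn w s (conf P l (some (.back, r)) ih (Function.update T r (tapeOf (some none) u))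
        (Function.update (fun _ => 0) r h) out)
      (conf P l none ih (Function.update T r (tapeOf (some none) u)) (fun _ => 0) out) := by
  induction h with
  | zero =>
    apply run_micro hl hih T hs
    simp only [tapeOf, micro, Option.map_none, Move.apply, update_tapeOf_zero]
    rw [Function.update_eq_self_iff.2 rfl]
    exact Relation.ReflTransGen.refl
  | succ h hind =>
    apply run_micro hl hih T hs
    have hr : tapeOf (some none) u (h + 1) = some (some u[h]) := by
      simp [tapeOf, List.getElem?_eq_getElem (show h < u.length by omega)]
    rw [show Function.update (tapeOf (some none) u) (h + 1) _ = tapeOf (some none) u from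
      Function.update_eq_self_iff.2 (by simp [hr, micro])]
    simp only [hr, micro, Option.map_some, Move.apply, Nat.add_sub_cancel]
    exact hind (by omega) (by omega)

/-- Needed when a decrement meets no digit one: the borrow has turned the zeros into ones, and since
the register was zero, writing zeros everywhere restores it. -/
theorem run_undo {l : List (Prog k)} (hl : l ∈ continuations P []) (r : Fin k)
    {ih : ℕ} (hih : ih ≤ w.length + 1) (T : Fin k → ℕ → Sym) (u v : List Bool) (out : List Bool)
    (hs : u.length < s) :
    P.machine.RunIn w s (conf P l (some (.undo, r)) ih
        (Function.update T r (tapeOf (some none) (u ++ v)))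
        (Function.update (fun _ => 0) r u.length) out)
      (conf P l.tail none ih
        (Function.update T r (tapeOf (some none) (List.replicate u.length false ++ v)))
        (fun _ => 0) out) := by
  induction u using List.reverseRecOn generalizing v with
  | nil =>
    apply run_micro hl hih T hs
    simp only [List.length_nil, tapeOf, micro, Option.map_none, Move.apply, update_tapeOf_zero]
    rw [Function.update_eq_self_iff.2 rfl]
    exact Relation.ReflTransGen.refl
  | append_singleton u b hind =>
    apply run_micro hl hih T hs
    rw [List.append_assoc, List.singleton_append, List.length_append, List.length_singleton,
      tapeOf_length]
    simp only [micro, Option.map_some, Move.apply, Nat.add_sub_cancel, update_tapeOf]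
    have := hind (false :: v) (by simp at hs; omega)
    rwa [show List.replicate u.length false ++ false :: v
      = List.replicate (u.length + 1) false ++ v by simp [List.replicate_succ']] at this

/-- In the induction `u` collects the digits the carry has crossed, and `v` holds those still ahead.
-/
theorem run_up {l : List (Prog k)} (hl : l ∈ continuations P []) (r : Fin k)
    {ih : ℕ} (hih : ih ≤ w.length + 1) (T : Fin k → ℕ → Sym) (u v : List Bool) (out : List Bool)
    (hs : u.length + v.length + 1 < s) :
    P.machine.RunIn w s (conf P l (some (.up, r)) ih
        (Function.update T r (tapeOf (some none) (u ++ v)))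
        (Function.update (fun _ => 0) r (u.length + 1)) out)
      (conf P l none ih (Function.update T r (tapeOf (some none) (u ++ binInc v)))
        (fun _ => 0) out) := by
  induction v generalizing u with
  | nil =>
    apply run_micro hl hih T (by omega)
    rw [List.append_nil, tapeOf_length_self]
    simp only [micro, Option.map_some, Move.apply, Nat.add_sub_cancel, update_tapeOf_end]
    exact run_back hl r hih T _ out _ (by simp) (by omega)
  | cons b v hind =>
    apply run_micro hl hih T (by omega)
    rw [tapeOf_length]
    cases b
    · simp only [micro, Option.map_some, Move.apply, Nat.add_sub_cancel, update_tapeOf]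
      exact run_back hl r hih T _ out _ (by simp) (by omega)
    · simp only [micro, Option.map_some, Move.apply, update_tapeOf]
      have := hind (u ++ [false]) (by simp at hs ⊢; omega)
      simpa [binInc] using this

theorem run_down_some {l : List (Prog k)} (hl : l ∈ continuations P [])
    (hl' : afterDecrement l ∈ continuations P []) (r : Fin k)
    {ih : ℕ} (hih : ih ≤ w.length + 1) (T : Fin k → ℕ → Sym) (u v v' : List Bool)
    (out : List Bool) (hv : binDec v = some v') (hs : u.length + v.length + 1 < s) :
    P.machine.RunIn w s (conf P l (some (.down, r)) ih
        (Function.update T r (tapeOf (some none) (u ++ v)))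
        (Function.update (fun _ => 0) r (u.length + 1)) out)
      (conf P (afterDecrement l) none ih
        (Function.update T r (tapeOf (some none) (u ++ v'))) (fun _ => 0) out) := by
  induction v generalizing u v' with
  | nil => simp [binDec] at hv
  | cons b v hind =>
    apply run_micro hl hih T (by omega)
    rw [tapeOf_length]
    cases b
    · simp only [binDec, Option.map_eq_some_iff] at hv
      obtain ⟨v'', hv'', rfl⟩ := hv
      simp only [micro, Option.map_some, Move.apply, update_tapeOf]
      have := hind (u ++ [true]) v'' hv'' (by simp at hs ⊢; omega)
      simpa using this
    · simp only [binDec, Option.some.injEq] at hv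
      subst hv
      simp only [micro, Option.map_some, Move.apply, Nat.add_sub_cancel, update_tapeOf]
      exact run_back hl' r hih T _ out _ (by simp) (by omega)

/-- Zero is detected only at the blank after the last digit, so decrement and zero test share one
sweep to the right. -/
theorem run_down_none {l : List (Prog k)} (hl : l ∈ continuations P []) (r : Fin k)
    {ih : ℕ} (hih : ih ≤ w.length + 1) (T : Fin k → ℕ → Sym) (u v : List Bool)
    (out : List Bool) (hv : binDec v = none) (hs : u.length + v.length + 1 < s) :
    P.machine.RunIn w s (conf P l (some (.down, r)) ih
        (Function.update T r (tapeOf (some none) (u ++ v)))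
        (Function.update (fun _ => 0) r (u.length + 1)) out)
      (conf P l.tail none ih (Function.update T r
        (tapeOf (some none) (List.replicate (u.length + v.length) false))) (fun _ => 0) out) := by
  induction v generalizing u with
  | nil =>
    apply run_micro hl hih T (by omega)
    have hr := tapeOf_length_self (some none) u
    rw [List.append_nil, show Function.update (tapeOf (some none) u) (u.length + 1) _
      = tapeOf (some none) u from Function.update_eq_self_iff.2 (by simp [hr, micro]), hr]
    simp only [micro, Option.map_some, Move.apply, Nat.add_sub_cancel]
    have := run_undo (s := s) hl r hih T u [] out (by omega)
    simpa using this
  | cons b v hind =>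
    apply run_micro hl hih T (by omega)
    rw [tapeOf_length]
    cases b
    · simp only [binDec, Option.map_eq_none_iff] at hv
      simp only [micro, Option.map_some, Move.apply, update_tapeOf]
      have := hind (u ++ [true]) hv (by simp at hs ⊢; omega)
      simp only [List.append_assoc, List.singleton_append, List.length_append,
        List.length_singleton] at this
      rw [show u.length + (false :: v).length = u.length + 1 + v.length by simp; ring]
      exact this
    · simp [binDec] at hv

/-- The tapes hold the contents `ρ` of the registers, written with at most as many digits as `B`
has. -/
def Represents (B : ℕ) (T : Fin k → ℕ → Sym) (ρ : Fin k → ℕ) : Prop :=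
  ∀ t, ∃ c u, T t = tapeOf c u ∧ binVal u = ρ t ∧ u.length ≤ B.size

theorem Represents.update {B : ℕ} {T : Fin k → ℕ → Sym} {ρ : Fin k → ℕ} (h : Represents B T ρ)
    (r : Fin k) (c : Sym) (u : List Bool) (hu : u.length ≤ B.size) :
    Represents B (Function.update T r (tapeOf c u)) (Function.update ρ r (binVal u)) := by
  intro t
  by_cases ht : t = r
  · subst ht
    exact ⟨c, u, by simp, by simp, hu⟩
  · simpa [ht] using h t

theorem run_dispatch {l : List (Prog k)} (hl : l ∈ continuations P []) {ih : ℕ}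
    {T : Fin k → ℕ → Sym} {out : List Bool} {c : P.machine.Cfg} (hs : 0 < s)
    {q : List (Prog k) × Option (Kind × Fin k)} {mv : Move} {act : Fin k → Sym × Move}
    {o : Option Bool}
    (hd : dispatch (inputCell w ih) (fun t => T t 0) l = some (q, mv, act, o))
    (hrun : P.machine.RunIn w s (conf P q.1 q.2 (min (mv.apply ih) (w.length + 1))
      (fun t => Function.update (T t) 0 (act t).1) (fun t => (act t).2.apply 0)
      (out ++ o.toList)) c) :
    P.machine.RunIn w s (conf P l none ih T (fun _ => 0) out) c := by
  refine Relation.ReflTransGen.head ⟨fun t => hs, ?_⟩ hrun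
  simp only [Machine.step, Prog.machine, conf, transition, clip_val hl]
  rw [hd]
  rfl

theorem idle_tape (T : Fin k → ℕ → Sym) :
    (fun t => Function.update (T t) 0 (idle (fun t => T t 0) t).1) = T := by
  funext t; simp [idle]

theorem idle_head (syms : Fin k → Sym) :
    (fun t => (idle syms t).2.apply 0) = fun _ => 0 := rfl

theorem startAction_tape (T : Fin k → ℕ → Sym) (r : Fin k) {c : Sym} {u : List Bool}
    (h : T r = tapeOf c u) :
    (fun t => Function.update (T t) 0 (startAction r (fun t => T t 0) t).1)
      = Function.update T r (tapeOf (some none) u) := by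
  funext t
  by_cases ht : t = r
  · subst ht; simp [startAction, h, update_tapeOf_zero]
  · simp [startAction, ht]

theorem startAction_head (syms : Fin k → Sym) (r : Fin k) :
    (fun t => (startAction r syms t).2.apply 0) = Function.update (fun _ => 0) r 1 := by
  funext t
  by_cases ht : t = r
  · subst ht; simp [startAction, Move.apply]
  · simp [startAction, ht, Move.apply]

theorem run_inc {B : ℕ} (r : Fin k) {l : List (Prog k)} (hl : .inc r :: l ∈ continuations P [])
    (hl' : l ∈ continuations P []) {ih : ℕ} (hih : ih ≤ w.length + 1) {T : Fin k → ℕ → Sym}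
    {ρ : Fin k → ℕ} (hT : Represents B T ρ) (out : List Bool) (hB : ρ r + 1 ≤ B)
    (hs : B.size + 1 < s) :
    ∃ T', Represents B T' (Function.update ρ r (ρ r + 1)) ∧
      P.machine.RunIn w s (conf P (.inc r :: l) none ih T (fun _ => 0) out)
        (conf P l none ih T' (fun _ => 0) out) := by
  obtain ⟨c, u, hTu, hval, hlen⟩ := hT r
  refine ⟨Function.update T r (tapeOf (some none) (binInc u)), ?_, ?_⟩
  · rw [← hval, ← binVal_binInc]
    refine hT.update r _ _ ?_
    rcases length_binInc u with h | ⟨h, h'⟩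
    · rwa [h]
    -- In this case the new content is `2 ^ u.length`, and it is at most `B`, so `B` has enough
    -- digits for the longer word.
    · rw [h, Nat.add_one_le_iff, Nat.lt_size]
      omega
  · refine run_dispatch hl (by omega) rfl ?_
    simp only [Move.apply_stay, min_eq_left hih, startAction_tape T r hTu, startAction_head,
      Option.toList_none, List.append_nil]
    exact run_up hl' r hih T [] u out (by rw [List.length_nil]; omega)

/-- Serves `pred` and `loop` alike: both start a decrement, and they differ only in the continuation
that `afterDecrement` selects on success. -/
theorem run_down {B : ℕ} (r : Fin k) {l : List (Prog k)} (hl : l ∈ continuations P [])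
    (hl' : afterDecrement l ∈ continuations P []) {ih : ℕ} (hih : ih ≤ w.length + 1)
    {T : Fin k → ℕ → Sym} {ρ : Fin k → ℕ} (hT : Represents B T ρ) (out : List Bool)
    (hs : B.size + 1 < s) (hd : dispatch (inputCell w ih) (fun t => T t 0) l =
      some ((l, some (.down, r)), .stay, startAction r (fun t => T t 0), none)) :
    ∃ T', Represents B T' (Function.update ρ r (ρ r - 1)) ∧
      P.machine.RunIn w s (conf P l none ih T (fun _ => 0) out)
        (conf P (if ρ r = 0 then l.tail else afterDecrement l) none ih T' (fun _ => 0) out) := by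
  obtain ⟨c, u, hTu, hval, hlen⟩ := hT r
  cases hdec : binDec u with
  | none =>
    refine ⟨Function.update T r (tapeOf (some none) (List.replicate u.length false)), ?_, ?_⟩
    · have h0 := binVal_eq_zero hdec
      rw [← hval, h0, Nat.zero_sub, ← binVal_replicate_false u.length]
      exact hT.update r _ _ (by simpa using hlen)
    · rw [if_pos (by rw [← hval]; exact binVal_eq_zero hdec)]
      refine run_dispatch hl (by omega) hd ?_
      simp only [Move.apply_stay, min_eq_left hih, startAction_tape T r hTu, startAction_head,
        Option.toList_none, List.append_nil]
      have := run_down_none (s := s) hl r hih T [] u out hdec (by rw [List.length_nil]; omega)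
      simpa using this
  | some v =>
    obtain ⟨h1, h2⟩ := binVal_binDec hdec
    refine ⟨Function.update T r (tapeOf (some none) v), ?_, ?_⟩
    · rw [← hval, h1, Nat.add_sub_cancel]
      exact hT.update r _ _ (by omega)
    · rw [if_neg (by omega)]
      refine run_dispatch hl (by omega) hd ?_
      simp only [Move.apply_stay, min_eq_left hih, startAction_tape T r hTu, startAction_head,
        Option.toList_none, List.append_nil]
      exact run_down_some hl hl' r hih T [] u v out hdec (by rw [List.length_nil]; omega)

/-- Induction on the execution. The rest `l` is arbitrary because a loop body runs in front of the
loop itself, and the first part of a sequence in front of the second. The inclusion of continuations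
ensures that `clip` changes nothing. -/
theorem Exec.simulate {B : ℕ} {Q : Prog k} {ρ ρ' : Fin k → ℕ} {o : List Bool}
    (hQ : Exec B Q ρ ρ' o) (hs : B.size + 1 < s) {ih : ℕ} (hih : ih ≤ w.length + 1) :
    ∀ (l : List (Prog k)) (T : Fin k → ℕ → Sym) (out : List Bool),
      continuations Q l ⊆ continuations P [] → Represents B T ρ →
      ∃ T', Represents B T' ρ' ∧
        P.machine.RunIn w s (conf P (Q :: l) none ih T (fun _ => 0) out)
          (conf P l none ih T' (fun _ => 0) (out ++ o)) := by
  induction hQ with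
  | skip ρ =>
    intro l T out hc hT
    refine ⟨T, hT, run_dispatch (hc (cons_mem_continuations _ _)) (by omega) rfl ?_⟩
    simp only [Move.apply_stay, min_eq_left hih, idle_tape, idle_head, Option.toList_none]
    exact Relation.ReflTransGen.refl
  | emit b ρ =>
    intro l T out hc hT
    refine ⟨T, hT, run_dispatch (hc (cons_mem_continuations _ _)) (by omega) rfl ?_⟩
    simp only [Move.apply_stay, min_eq_left hih, idle_tape, idle_head, Option.toList_some]
    exact Relation.ReflTransGen.refl
  | inc r ρ hB =>
    intro l T out hc hT
    rw [List.append_nil]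
    exact run_inc r (hc (cons_mem_continuations _ _)) (hc (mem_continuations _ _)) hih hT out hB hs
  | pred r ρ =>
    intro l T out hc hT
    rw [List.append_nil]
    have := run_down r (hc (cons_mem_continuations _ _)) (hc (mem_continuations _ _)) hih hT out hs
      rfl
    simpa [afterDecrement] using this
  | @seq Q₁ Q₂ ρ ρ' ρ'' o o' _ _ ih1 ih2 =>
    intro l T out hc hT
    obtain ⟨T₁, hT₁, hr₁⟩ := ih1 (Q₂ :: l) T out
      (fun _ h => hc (Or.inl (Or.inr h))) hT
    obtain ⟨T₂, hT₂, hr₂⟩ := ih2 l T₁ (out ++ o) (fun _ h => hc (Or.inr h)) hT₁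
    refine ⟨T₂, hT₂, run_dispatch (hc (cons_mem_continuations _ _)) (by omega) rfl ?_⟩
    simp only [Move.apply_stay, min_eq_left hih, idle_tape, idle_head, Option.toList_none,
      List.append_nil]
    rw [← List.append_assoc]
    exact hr₁.trans hr₂
  | @loop_zero r Q ρ h0 =>
    intro l T out hc hT
    rw [List.append_nil]
    have := run_down r (hc (cons_mem_continuations _ _))
      (hc (Or.inr (cons_mem_continuations _ _))) hih hT out hs rfl
    rwa [if_pos h0, Function.update_eq_self_iff.2 (by omega)] at this
  | @loop_succ r Q ρ ρ' ρ'' o o' h0 _ _ ih1 ih2 =>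
    intro l T out hc hT
    obtain ⟨T₁, hT₁, hr₁⟩ := run_down r (hc (cons_mem_continuations _ _))
      (hc (Or.inr (cons_mem_continuations _ _))) hih hT out hs rfl
    rw [if_neg h0] at hr₁
    obtain ⟨T₂, hT₂, hr₂⟩ := ih1 (.loop r Q :: l) T₁ out (fun _ h => hc (Or.inr h)) hT₁
    obtain ⟨T₃, hT₃, hr₃⟩ := ih2 l T₂ (out ++ o) hc hT₂
    refine ⟨T₃, hT₃, ?_⟩
    rw [← List.append_assoc]
    exact (hr₁.trans hr₂).trans hr₃

theorem inputCell_rightEnd : inputCell w (w.length + 1) = .rightEnd := by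
  simp [inputCell]

theorem inputCell_ne_rightEnd {a : ℕ} (h : a ≤ w.length) : inputCell w a ≠ .rightEnd := by
  unfold inputCell
  split_ifs with h0
  · simp
  · rw [List.getElem?_eq_getElem (by omega)]
    simp

/-- `m` is the distance to the right end marker. From cell `0` it counts the left end marker too,
hence the length of the input plus one. -/
theorem run_load {B : ℕ} (r : Fin k) {l : List (Prog k)}
    (hl : continuations (.load r) l ⊆ continuations P []) (hs : B.size + 1 < s)
    (out : List Bool) (m : ℕ) :
    ∀ (ih : ℕ) (T : Fin k → ℕ → Sym) (ρ : Fin k → ℕ), ih + m = w.length + 1 →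
      Represents B T ρ → ρ r + m ≤ B →
    ∃ T', Represents B T' (Function.update ρ r (ρ r + m)) ∧
      P.machine.RunIn w s (conf P (.load r :: l) none ih T (fun _ => 0) out)
        (conf P l none (w.length + 1) T' (fun _ => 0) out) := by
  have hload : .load r :: l ∈ continuations P [] := hl (cons_mem_continuations _ _)
  induction m with
  | zero =>
    intro ih T ρ hih hT hB
    obtain rfl : ih = w.length + 1 := by omega
    have hd : dispatch (inputCell w (w.length + 1)) (fun t => T t 0) (.load r :: l)
        = some ((l, none), .stay, idle fun t => T t 0, none) := by
      rw [inputCell_rightEnd]; rfl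
    refine ⟨T, by simpa using hT, run_dispatch hload (by omega) hd ?_⟩
    simp only [Move.apply_stay, min_self, idle_tape, idle_head, Option.toList_none,
      List.append_nil]
    exact Relation.ReflTransGen.refl
  | succ m hind =>
    intro ih T ρ hih hT hB
    obtain ⟨T₁, hT₁, hr₁⟩ := run_inc (w := w) r (l := .load r :: l) (hl (by simp [continuations]))
      hload (ih := ih + 1) (by omega) hT out (by omega) hs
    obtain ⟨T₂, hT₂, hr₂⟩ := hind (ih + 1) T₁ _ (by omega) hT₁ (by simp; omega)
    refine ⟨T₂, ?_, run_dispatch hload (by omega) (q := (.inc r :: .load r :: l, none))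
      (mv := .right) (act := idle fun t => T t 0) (o := none) ?_ ?_⟩
    · simp only [Function.update_self, Function.update_idem] at hT₂
      rwa [show ρ r + (m + 1) = ρ r + 1 + m by ring]
    · have := inputCell_ne_rightEnd (w := w) (a := ih) (by omega)
      generalize inputCell w ih = cell at this
      cases cell
      · rfl
      · rfl
      · exact absurd rfl this
    · simp only [Move.apply_right, min_eq_left (show ih + 1 ≤ w.length + 1 by omega), idle_tape,
        idle_head, Option.toList_none, List.append_nil]
      exact hr₁.trans hr₂

end Simulation

/-- A program that starts with the length of the input (plus one) in register `r` is run by a Turing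
machine, in space the number of digits of a bound for the registers. -/
theorem Exec.computesInSpace {B : ℕ} {Q : Prog k} {ρ' : Fin k → ℕ} {o w : List Bool} (r : Fin k)
    (hQ : Exec B Q (Function.update (fun _ => 0) r (w.length + 1)) ρ' o)
    (hB : w.length + 1 ≤ B) :
    (Prog.seq (.load r) Q).machine.ComputesInSpace w o (B.size + 2) := by
  set P : Prog k := .seq (.load r) Q with hP
  have start_eq : P.machine.init = conf P [P] none 0 (fun _ _ => none) (fun _ => 0) [] := rfl
  have hT₀ : Represents B (fun _ _ => none) (fun _ : Fin k => 0) :=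
    fun t => ⟨none, [], tapeOf_nil.symm, rfl, by simp⟩
  obtain ⟨T₁, hT₁, hr₁⟩ := run_load (P := P) (w := w) (s := B.size + 2) r (l := [Q])
    (fun _ h => Or.inl (Or.inr h)) (by omega) [] (w.length + 1) 0 _ _ (by omega) hT₀ (by omega)
  rw [Nat.zero_add] at hT₁
  obtain ⟨T₂, hT₂, hr₂⟩ := hQ.simulate (P := P) (w := w) (s := B.size + 2) (by omega) le_rfl []
    T₁ [] (fun _ h => Or.inr h) hT₁
  have hrun : P.machine.RunIn w (B.size + 2) P.machine.init
      (conf P [] none (w.length + 1) T₂ (fun _ => 0) o) := by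
    rw [start_eq]
    refine run_dispatch (cons_mem_continuations _ _) (by omega) rfl ?_
    simp only [Move.apply_stay, min_eq_left (Nat.zero_le _), idle_tape, idle_head,
      Option.toList_none]
    exact hr₁.trans hr₂
  have hhalt : P.machine.step w (conf P [] none (w.length + 1) T₂ (fun _ => 0) o) = none := by
    simp only [Machine.step, Prog.machine, conf, transition, clip_val (mem_continuations P [])]
    rfl
  exact ⟨⟨_, hrun.reaches, hhalt, rfl⟩, hrun.bound (fun t => by simp [conf]) hhalt⟩

end TM


/-! ### Circuits built from blocks -/

/-- `Q` holds for all the elements of a list together with their indices, which start at `b`. -/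
def IdxAll {γ : Type} (Q : ℕ → γ → Prop) : ℕ → List γ → Prop
  | _, [] => True
  | b, g :: l => Q b g ∧ IdxAll Q (b + 1) l

section IdxAll

variable {γ : Type} {Q : ℕ → γ → Prop}

theorem idxAll_append {b : ℕ} {l₁ l₂ : List γ} :
    IdxAll Q b (l₁ ++ l₂) ↔ IdxAll Q b l₁ ∧ IdxAll Q (b + l₁.length) l₂ := by
  induction l₁ generalizing b with
  | nil => simp [IdxAll]
  | cons g l ih => simp [IdxAll, ih, and_assoc, Nat.add_comm, Nat.add_left_comm]

theorem idxAll_singleton {b : ℕ} {g : γ} : IdxAll Q b [g] ↔ Q b g := by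
  simp [IdxAll]

theorem idxAll_iff {b : ℕ} {l : List γ} :
    IdxAll Q b l ↔ ∀ (i : ℕ) (h : i < l.length), Q (b + i) l[i] := by
  induction l generalizing b with
  | nil => simp [IdxAll]
  | cons g l ih =>
    simp only [IdxAll, ih, List.length_cons]
    constructor
    · rintro ⟨h0, h1⟩ i hi
      cases i with
      | zero => exact h0
      | succ i =>
        have := h1 i (by omega)
        simpa [Nat.add_assoc, Nat.add_comm 1] using this
    · intro h
      refine ⟨h 0 (by omega), fun i hi => ?_⟩
      have := h (i + 1) (by omega)
      simpa [Nat.add_assoc, Nat.add_comm 1] using this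

theorem idxAll_replicate {b m : ℕ} {g : γ} (h : ∀ i, Q i g) :
    IdxAll Q b (List.replicate m g) := by
  simp [idxAll_iff, h]

theorem length_flatMap_range {f : ℕ → List γ} {β : ℕ} (n : ℕ) (hf : ∀ i < n, (f i).length = β) :
    ((List.range n).flatMap f).length = β * n := by
  induction n with
  | zero => simp
  | succ n ih =>
    rw [List.range_succ, List.flatMap_append, List.length_append, ih fun i hi => hf i (by omega),
      List.flatMap_singleton, hf n (by omega), Nat.mul_succ]

/-- Blocks of equal length start at multiples of that length, so a statement about all gates splits
into statements about blocks at known positions. -/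
theorem idxAll_flatMap_range {f : ℕ → List γ} {β b n : ℕ} (hf : ∀ i < n, (f i).length = β) :
    IdxAll Q b ((List.range n).flatMap f) ↔ ∀ i < n, IdxAll Q (b + β * i) (f i) := by
  induction n with
  | zero => simp [IdxAll]
  | succ n ih =>
    have hf' : ∀ i < n, (f i).length = β := fun i hi => hf i (by omega)
    rw [List.range_succ, List.flatMap_append, idxAll_append, ih hf', length_flatMap_range n hf',
      List.flatMap_singleton]
    constructor
    · rintro ⟨h1, h2⟩ i hi
      rcases Nat.lt_succ_iff_lt_or_eq.1 hi with h | rfl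
      · exact h1 i h
      · exact h2
    · exact fun h => ⟨fun i hi => h i (by omega), h n (by omega)⟩

end IdxAll

namespace Circ

/-! ### Equations for the values and depths of gates -/

theorem Circuit.values_append (x : List Bool) (C : Circuit) (g : Gate) :
    Circuit.values x (C ++ [g]) = Circuit.values x C ++ [g.value x (Circuit.values x C)] := by
  simp [Circuit.values]

theorem Circuit.length_values (x : List Bool) (C : Circuit) :
    (Circuit.values x C).length = C.length := by
  induction C using List.reverseRecOn with
  | nil => rfl
  | append_singleton C g ih => simp [Circuit.values_append, ih]

theorem Circuit.depths_append (C : Circuit) (g : Gate) :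
    Circuit.depths (C ++ [g]) = Circuit.depths C ++ [g.depth (Circuit.depths C)] := by
  simp [Circuit.depths]

theorem Circuit.length_depths (C : Circuit) : (Circuit.depths C).length = C.length := by
  induction C using List.reverseRecOn with
  | nil => rfl
  | append_singleton C g ih => simp [Circuit.depths_append, ih]

theorem Gate.value_congr {x v v' : List Bool} {n m : ℕ} {g : Gate} (hg : g.WellFormed n m)
    (h : ∀ j < m, v.getD j false = v'.getD j false) : g.value x v = g.value x v' := by
  cases g with
  | input i => rfl
  | const b => rfl
  | not j => simp only [Gate.value, h j hg]
  | and j k => simp only [Gate.value, h j hg.1, h k hg.2]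
  | or j k => simp only [Gate.value, h j hg.1, h k hg.2]

theorem Gate.depth_congr {d d' : List ℕ} {n m : ℕ} {g : Gate} (hg : g.WellFormed n m)
    (h : ∀ j < m, d.getD j 0 = d'.getD j 0) : g.depth d = g.depth d' := by
  cases g with
  | input i => rfl
  | const b => rfl
  | not j => simp only [Gate.depth, h j hg]
  | and j k => simp only [Gate.depth, h j hg.1, h k hg.2]
  | or j k => simp only [Gate.depth, h j hg.1, h k hg.2]

/-- The values of the gates satisfy the equations given by the gates. -/
theorem Circuit.idxAll_values {n : ℕ} {C : Circuit} (x : List Bool)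
    (h : IdxAll (fun m g => g.WellFormed n m) 0 C) :
    IdxAll (fun m g => (Circuit.values x C).getD m false = g.value x (Circuit.values x C)) 0 C := by
  induction C using List.reverseRecOn with
  | nil => trivial
  | append_singleton C g ih =>
    rw [idxAll_append, idxAll_singleton, Nat.zero_add] at h ⊢
    have hpre : ∀ j < C.length, (Circuit.values x C).getD j false
        = (Circuit.values x (C ++ [g])).getD j false := fun j hj => by
      rw [Circuit.values_append, List.getD_append _ _ _ _ (by rwa [Circuit.length_values])]
    refine ⟨?_, ?_⟩
    · have h1 := ih h.1
      have h2 := h.1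
      rw [idxAll_iff] at h1 h2 ⊢
      intro i hi
      have e1 := h1 i hi
      have e2 := h2 i hi
      simp only [Nat.zero_add] at e1 e2 ⊢
      rw [← hpre i hi, e1]
      exact Gate.value_congr e2 fun j hj => hpre j (by omega)
    · rw [← Gate.value_congr h.2 hpre, Circuit.values_append,
        List.getD_append_right _ _ _ _ (by rw [Circuit.length_values]), Circuit.length_values]
      simp

/-- The depths of the gates satisfy the equations given by the gates. -/
theorem Circuit.idxAll_depths {n : ℕ} {C : Circuit}
    (h : IdxAll (fun m g => g.WellFormed n m) 0 C) :
    IdxAll (fun m g => (Circuit.depths C).getD m 0 = g.depth (Circuit.depths C)) 0 C := by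
  induction C using List.reverseRecOn with
  | nil => trivial
  | append_singleton C g ih =>
    rw [idxAll_append, idxAll_singleton, Nat.zero_add] at h ⊢
    have hpre : ∀ j < C.length, (Circuit.depths C).getD j 0
        = (Circuit.depths (C ++ [g])).getD j 0 := fun j hj => by
      rw [Circuit.depths_append, List.getD_append _ _ _ _ (by rwa [Circuit.length_depths])]
    refine ⟨?_, ?_⟩
    · have h1 := ih h.1
      have h2 := h.1
      rw [idxAll_iff] at h1 h2 ⊢
      intro i hi
      have e1 := h1 i hi
      have e2 := h2 i hi
      simp only [Nat.zero_add] at e1 e2 ⊢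
      rw [← hpre i hi, e1]
      exact Gate.depth_congr e2 fun j hj => hpre j (by omega)
    · rw [← Gate.depth_congr h.2 hpre, Circuit.depths_append,
        List.getD_append_right _ _ _ _ (by rw [Circuit.length_depths]), Circuit.length_depths]
      simp

theorem Circuit.eval_eq (x : List Bool) (C : Circuit) :
    Circuit.eval x C = (Circuit.values x C).getD (C.length - 1) false := by
  rw [Circuit.eval, List.getLastD_eq_getLast?, List.getLast?_eq_getElem?, Circuit.length_values,
    List.getD_eq_getElem?_getD]

theorem Circuit.depth_le {C : Circuit} {D : ℕ}
    (h : ∀ m < C.length, (Circuit.depths C).getD m 0 ≤ D) : C.depth ≤ D := by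
  have key : ∀ l : List ℕ, (∀ a ∈ l, a ≤ D) → l.foldr max 0 ≤ D := by
    intro l hl
    induction l with
    | nil => simp
    | cons a l ih =>
      simp only [List.foldr_cons, max_le_iff]
      exact ⟨hl a (by simp), ih fun b hb => hl b (by simp [hb])⟩
  refine key _ fun a ha => ?_
  obtain ⟨m, hm, rfl⟩ := List.getElem_of_mem ha
  rw [← List.getD_eq_getElem _ 0 hm]
  exact h m (by rwa [Circuit.length_depths] at hm)

/-! ### Gate templates and compiled formulas -/

/-- Gates whose arguments are given relative to bases. -/
inductive TGate (R : Type) : Type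
  | input (r : R)
  | const (b : Bool)
  | not (a : R × ℕ)
  | and (a b : R × ℕ)
  | or (a b : R × ℕ)

/-- The gate obtained by fixing the bases. -/
def TGate.inst {R : Type} (ρ : R → ℕ) : TGate R → Gate
  | .input r => .input (ρ r)
  | .const b => .const b
  | .not a => .not (ρ a.1 + a.2)
  | .and a b => .and (ρ a.1 + a.2) (ρ b.1 + b.2)
  | .or a b => .or (ρ a.1 + a.2) (ρ b.1 + b.2)

/-- Boolean formulas. -/
inductive Formula (α : Type) : Type
  | var (a : α)
  | const (b : Bool)
  | not (φ : Formula α)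
  | and (φ ψ : Formula α)
  | or (φ ψ : Formula α)

namespace Formula

variable {α R : Type}

/-- The value of a formula. -/
def eval (v : α → Bool) : Formula α → Bool
  | var a => v a
  | const b => b
  | not φ => !(φ.eval v)
  | and φ ψ => φ.eval v && ψ.eval v
  | or φ ψ => φ.eval v || ψ.eval v

/-- The number of nodes of a formula. -/
def size : Formula α → ℕ
  | var _ => 1
  | const _ => 1
  | not φ => φ.size + 1
  | and φ ψ => φ.size + ψ.size + 1
  | or φ ψ => φ.size + ψ.size + 1

theorem size_pos (φ : Formula α) : 0 < φ.size := by
  cases φ <;> simp [size]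

/-- Every Boolean function of finitely many variables is given by a formula. -/
theorem exists_eval_eq [Finite α] (f : (α → Bool) → Bool) :
    ∃ φ : Formula α, ∀ v, φ.eval v = f v := by
  classical
  have := Fintype.ofFinite α
  have key : ∀ (s : Finset α) (f : (α → Bool) → Bool),
      (∀ v v', (∀ a ∈ s, v a = v' a) → f v = f v') → ∃ φ : Formula α, ∀ v, φ.eval v = f v := by
    intro s
    induction s using Finset.induction_on with
    | empty =>
      intro f hf
      exact ⟨const (f fun _ => false), fun v => hf _ _ (by simp)⟩
    | insert a s _ ih =>
      intro f hf
      have h : ∀ b, ∃ φ : Formula α, ∀ v, φ.eval v = f (Function.update v a b) := by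
        intro b
        refine ih _ fun v v' hv => hf _ _ fun a' ha' => ?_
        by_cases haa : a' = a
        · subst haa; simp
        · simp [haa, hv a' (Finset.mem_of_mem_insert_of_ne ha' haa)]
      obtain ⟨φ₁, h₁⟩ := h true
      obtain ⟨φ₀, h₀⟩ := h false
      -- Shannon expansion on the variable `a`.
      refine ⟨or (and (var a) φ₁) (and (not (var a)) φ₀), fun v => ?_⟩
      have hv := Function.update_eq_self a v
      cases hva : v a <;> rw [hva] at hv <;> simp [eval, h₁, h₀, hva, hv]
  exact key Finset.univ f fun v v' h => by rw [funext fun a => h a (Finset.mem_univ a)]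

/-- The gates computing a formula, placed at the offset `o` from the base `A`; the gates for the
variables are given by `vg`. -/
def compile (A : R) (vg : α → TGate R) : Formula α → ℕ → List (TGate R)
  | var a, _ => [vg a]
  | const b, _ => [.const b]
  | not φ, o => φ.compile A vg o ++ [.not (A, o + φ.size - 1)]
  | and φ ψ, o => φ.compile A vg o ++ ψ.compile A vg (o + φ.size) ++
      [.and (A, o + φ.size - 1) (A, o + φ.size + ψ.size - 1)]
  | or φ ψ, o => φ.compile A vg o ++ ψ.compile A vg (o + φ.size) ++
      [.or (A, o + φ.size - 1) (A, o + φ.size + ψ.size - 1)]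

theorem length_compile (A : R) (vg : α → TGate R) (φ : Formula α) (o : ℕ) :
    (φ.compile A vg o).length = φ.size := by
  induction φ generalizing o <;> simp [compile, size, Nat.add_assoc, *]

/-- The result of a formula is its last gate. Only the gate equations are used, so the formula may
stand anywhere in a circuit. -/
theorem getD_compile {A : R} {vg : α → TGate R} {ρ : R → ℕ} {x v : List Bool} {val : α → Bool}
    (hvg : ∀ a, ((vg a).inst ρ).value x v = val a) (φ : Formula α) (o : ℕ)
    (h : IdxAll (fun m g => v.getD m false = g.value x v) (ρ A + o)
      ((φ.compile A vg o).map (TGate.inst ρ))) :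
    v.getD (ρ A + (o + φ.size - 1)) false = φ.eval val := by
  induction φ generalizing o with
  | var a =>
    simp only [compile, List.map_cons, List.map_nil, idxAll_singleton] at h
    simpa [size, eval, hvg] using h
  | const b =>
    simp only [compile, List.map_cons, List.map_nil, idxAll_singleton] at h
    simpa [size, eval, TGate.inst, Gate.value] using h
  | not φ ih =>
    simp only [compile, List.map_append, List.map_cons, List.map_nil, idxAll_append,
      idxAll_singleton, List.length_map, length_compile, TGate.inst, Gate.value] at h
    rw [ih o h.1] at h
    rw [eval, ← h.2]
    congr 1
    simp [size]; ring
  | and φ ψ ih₁ ih₂ =>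
    simp only [compile, List.map_append, List.map_cons, List.map_nil, idxAll_append,
      idxAll_singleton, List.length_map, List.length_append, length_compile, TGate.inst,
      Gate.value] at h
    rw [ih₁ o h.1.1, ih₂ (o + φ.size) (by rw [← Nat.add_assoc]; exact h.1.2)] at h
    rw [eval, ← h.2]
    congr 1
    simp [size]; ring
  | or φ ψ ih₁ ih₂ =>
    simp only [compile, List.map_append, List.map_cons, List.map_nil, idxAll_append,
      idxAll_singleton, List.length_map, List.length_append, length_compile, TGate.inst,
      Gate.value] at h
    rw [ih₁ o h.1.1, ih₂ (o + φ.size) (by rw [← Nat.add_assoc]; exact h.1.2)] at h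
    rw [eval, ← h.2]
    congr 1
    simp [size]; ring

/-- A property of gates that is implied by the arguments being gates from the base on. -/
structure Local (base : ℕ) (Q : ℕ → Gate → Prop) : Prop where
  const : ∀ m b, Q m (.const b)
  not : ∀ m j, base ≤ j → j < m → Q m (.not j)
  and : ∀ m j k, base ≤ j → j < m → base ≤ k → k < m → Q m (.and j k)
  or : ∀ m j k, base ≤ j → j < m → base ≤ k → k < m → Q m (.or j k)

/-- Apart from the variables, compiled gates refer only to gates from the base on. A property that
is `Local`, such as well-formedness or the depth bound, thus needs a check at the variables only. -/
theorem idxAll_compile {A : R} {vg : α → TGate R} {ρ : R → ℕ} {Q : ℕ → Gate → Prop}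
    (hQ : Local (ρ A) Q) (hvg : ∀ m a, ρ A ≤ m → Q m ((vg a).inst ρ)) (φ : Formula α) (o : ℕ) :
    IdxAll Q (ρ A + o) ((φ.compile A vg o).map (TGate.inst ρ)) := by
  induction φ generalizing o with
  | var a => simpa [compile, IdxAll] using hvg _ a (by omega)
  | const b => simpa [compile, IdxAll, TGate.inst] using hQ.const _ b
  | not φ ih =>
    simp only [compile, List.map_append, List.map_cons, List.map_nil, idxAll_append,
      idxAll_singleton, List.length_map, length_compile, TGate.inst]
    have := φ.size_pos
    exact ⟨ih o, hQ.not _ _ (by omega) (by omega)⟩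
  | and φ ψ ih₁ ih₂ =>
    simp only [compile, List.map_append, List.map_cons, List.map_nil, idxAll_append,
      idxAll_singleton, List.length_map, List.length_append, length_compile, TGate.inst]
    have := φ.size_pos
    have := ψ.size_pos
    refine ⟨⟨ih₁ o, by rw [Nat.add_assoc]; exact ih₂ _⟩,
      hQ.and _ _ _ (by omega) (by omega) (by omega) (by omega)⟩
  | or φ ψ ih₁ ih₂ =>
    simp only [compile, List.map_append, List.map_cons, List.map_nil, idxAll_append,
      idxAll_singleton, List.length_map, List.length_append, length_compile, TGate.inst]
    have := φ.size_pos
    have := ψ.size_pos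
    refine ⟨⟨ih₁ o, by rw [Nat.add_assoc]; exact ih₂ _⟩,
      hQ.or _ _ _ (by omega) (by omega) (by omega) (by omega)⟩

/-- The gates computing the first `W` formulas of a sequence, each one with `c` gates. -/
def block (A : R) (vg : α → TGate R) (W c : ℕ) (φ : ℕ → Formula α) : List (TGate R) :=
  (List.range W).flatMap fun i => List.replicate (c - (φ i).size) (.const false) ++
    (φ i).compile A vg (c * i + (c - (φ i).size))

variable {A : R} {vg : α → TGate R} {W c : ℕ} {φ : ℕ → Formula α}

theorem length_block (hc : ∀ i < W, (φ i).size ≤ c) : (block A vg W c φ).length = c * W := by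
  refine length_flatMap_range W fun i hi => ?_
  have := hc i hi
  simp [length_compile]; omega

theorem map_block (ρ : R → ℕ) : (block A vg W c φ).map (TGate.inst ρ) =
    (List.range W).flatMap fun i => List.replicate (c - (φ i).size) (.const false) ++
      ((φ i).compile A vg (c * i + (c - (φ i).size))).map (TGate.inst ρ) := by
  rw [block, List.map_flatMap]
  simp [TGate.inst]

/-- The constant gates put in front make each formula end exactly at the end of its `c` gates, so
the position of a result depends only on its index. -/
theorem getD_block {ρ : R → ℕ} {x v : List Bool} {val : α → Bool} (hc : ∀ i < W, (φ i).size ≤ c)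
    (hvg : ∀ a, ((vg a).inst ρ).value x v = val a)
    (h : IdxAll (fun m g => v.getD m false = g.value x v) (ρ A)
      ((block A vg W c φ).map (TGate.inst ρ))) {i : ℕ} (hi : i < W) :
    v.getD (ρ A + (c * i + c - 1)) false = (φ i).eval val := by
  rw [map_block, idxAll_flatMap_range (β := c) fun i hi => by
    have := hc i hi
    simp [length_compile]; omega] at h
  have hi' := h i hi
  rw [idxAll_append, List.length_replicate, Nat.add_assoc] at hi'
  have := getD_compile hvg (φ i) _ hi'.2
  have hci := hc i hi
  rw [← this]
  congr 2
  omega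

theorem idxAll_block {ρ : R → ℕ} {Q : ℕ → Gate → Prop} (hc : ∀ i < W, (φ i).size ≤ c)
    (hQ : Local (ρ A) Q) (hvg : ∀ m a, ρ A ≤ m → Q m ((vg a).inst ρ)) :
    IdxAll Q (ρ A) ((block A vg W c φ).map (TGate.inst ρ)) := by
  rw [map_block, idxAll_flatMap_range (β := c) fun i hi => by
    have := hc i hi
    simp [length_compile]; omega]
  intro i hi
  rw [idxAll_append, List.length_replicate, Nat.add_assoc]
  exact ⟨idxAll_replicate fun m => hQ.const m false, idxAll_compile hQ hvg _ _⟩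

end Formula

/-! ### Depth inside a block -/

/-- In a list of gates from `base` on, the depth bounds propagate from earlier gates. -/
def DepthStep (base D : ℕ) (d : List ℕ) (m : ℕ) (g : Gate) : Prop :=
  (∀ j, base ≤ j → j < m → d.getD j 0 ≤ D + (j - base)) → g.depth d ≤ D + (m - base)

theorem local_depthStep (base D : ℕ) (d : List ℕ) : Formula.Local base (DepthStep base D d) where
  const m b _ := by simp [Gate.depth]
  not m j h1 h2 h := by
    have := h j h1 h2
    simp only [Gate.depth]; omega
  and m j k h1 h2 h3 h4 h := by
    have := h j h1 h2
    have := h k h3 h4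
    simp only [Gate.depth]; omega
  or m j k h1 h2 h3 h4 h := by
    have := h j h1 h2
    have := h k h3 h4
    simp only [Gate.depth]; omega

/-- Depth grows by at most one per gate. This crude bound suffices, since blocks have constant size.
-/
theorem depth_le_of_idxAll {base D : ℕ} {d : List ℕ} {l : List Gate}
    (h : IdxAll (DepthStep base D d) base l)
    (hd : IdxAll (fun m g => d.getD m 0 = g.depth d) base l) :
    ∀ i < l.length, d.getD (base + i) 0 ≤ D + i := by
  rw [idxAll_iff] at h hd
  intro i
  induction i using Nat.strong_induction_on with
  | _ i ih =>
    intro hi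
    rw [hd i hi]
    have := h i hi fun j h1 h2 => by
      have := ih (j - base) (by omega) (by omega)
      rwa [Nat.add_sub_cancel' h1] at this
    omega

end Circ


/-! ### Tree-like circuits -/

namespace Circ

/-- The formulas from which the circuits of a family are built. The circuit for inputs of length `n`
is a complete binary tree of blocks with at least `n` leaves; each block has `width` results, every
one computed by `cell` gates. The first `n` leaves read the input, `unit` gives the results of the
other leaves, `node` those of an inner block from the ones of its two children (`false` is the left
one), and `out` the output from the results at the root. -/
structure Scheme where
  width : ℕ
  cell : ℕ
  leaf : ℕ → Formula Unit
  unit : ℕ → Formula Empty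
  node : ℕ → Formula (Bool × Fin width)
  out : Formula (Fin width)
  leaf_le : ∀ i < width, (leaf i).size ≤ cell
  unit_le : ∀ i < width, (unit i).size ≤ cell
  node_le : ∀ i < width, (node i).size ≤ cell

namespace Scheme

variable (S : Scheme)

/-- The number of gates of a block. -/
def blk : ℕ := S.cell * S.width

/-- The position of a result in its block. -/
def pos (i : ℕ) : ℕ := S.cell * i + S.cell - 1

theorem pos_lt {i : ℕ} (hi : i < S.width) : S.pos i < S.blk := by
  have h1 := (S.leaf i).size_pos
  have h2 := S.leaf_le i hi
  have h3 : S.cell * (i + 1) ≤ S.cell * S.width := Nat.mul_le_mul_left _ hi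
  simp only [pos, blk, Nat.mul_succ] at h3 ⊢
  omega

/-- The gates of a leaf. Base `0` is the number of an input, base `1` the number of the first gate
of the block, and base `2` that of the first gate of the left child. -/
def leafT : List (TGate (Fin 3)) :=
  Formula.block 1 (fun _ => .input 0) S.width S.cell S.leaf

/-- The gates of a leaf beyond the end of the input. -/
def unitT : List (TGate (Fin 3)) :=
  Formula.block 1 Empty.elim S.width S.cell S.unit

/-- The gate that reads a result of a child. -/
def childGate (a : Bool × Fin S.width) : TGate (Fin 3) :=
  .or (2, (if a.1 then S.blk else 0) + S.pos a.2) (2, (if a.1 then S.blk else 0) + S.pos a.2)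

/-- The gates of an inner block. -/
def nodeT : List (TGate (Fin 3)) :=
  Formula.block 1 S.childGate S.width S.cell S.node

/-- The gates for the output. -/
def outT : List (TGate (Fin 3)) :=
  S.out.compile 1 (fun i => S.childGate (false, i)) 0

/-- The number of leaves of the circuit for inputs of length `n`. -/
def leaves (n : ℕ) : ℕ := 2 ^ (n + 1).size

theorem lt_leaves (n : ℕ) : n + 1 < leaves n := Nat.lt_size_self _

/-- The circuit for inputs of length `n`: the children of the inner block number `c` are the blocks
number `2 * c` and `2 * c + 1`. -/
def circuit (n : ℕ) : Circuit :=
  ((List.range n).flatMap fun j => S.leafT.map (TGate.inst ![j, S.blk * j, 0])) ++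
  ((List.range (leaves n - n)).flatMap fun j =>
    S.unitT.map (TGate.inst ![n, S.blk * (n + j), 0])) ++
  ((List.range (leaves n - 1)).flatMap fun c =>
    S.nodeT.map (TGate.inst ![n, S.blk * (leaves n + c), S.blk * (2 * c)])) ++
  S.outT.map (TGate.inst ![n, S.blk * (2 * leaves n - 1), S.blk * (2 * leaves n - 2)])

theorem length_leafT : S.leafT.length = S.blk := Formula.length_block S.leaf_le

theorem length_unitT : S.unitT.length = S.blk := Formula.length_block S.unit_le

theorem length_nodeT : S.nodeT.length = S.blk := Formula.length_block S.node_le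

theorem length_outT : S.outT.length = S.out.size := Formula.length_compile _ _ _ _

theorem length_circuit (n : ℕ) :
    (S.circuit n).length = S.blk * (2 * leaves n - 1) + S.out.size := by
  have h := lt_leaves n
  simp only [circuit, List.length_append, List.length_map, length_outT]
  rw [length_flatMap_range (β := S.blk) _ fun i _ => by simp [length_leafT],
    length_flatMap_range (β := S.blk) _ fun i _ => by simp [length_unitT],
    length_flatMap_range (β := S.blk) _ fun i _ => by simp [length_nodeT],
    ← Nat.mul_add, ← Nat.mul_add]
  congr 2
  omega

theorem idxAll_circuit {Q : ℕ → Gate → Prop} {n : ℕ} : IdxAll Q 0 (S.circuit n) ↔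
    (∀ j < n, IdxAll Q (S.blk * j) (S.leafT.map (TGate.inst ![j, S.blk * j, 0]))) ∧
    (∀ j < leaves n - n, IdxAll Q (S.blk * (n + j))
      (S.unitT.map (TGate.inst ![n, S.blk * (n + j), 0]))) ∧
    (∀ c < leaves n - 1, IdxAll Q (S.blk * (leaves n + c))
      (S.nodeT.map (TGate.inst ![n, S.blk * (leaves n + c), S.blk * (2 * c)]))) ∧
    IdxAll Q (S.blk * (2 * leaves n - 1))
      (S.outT.map
        (TGate.inst ![n, S.blk * (2 * leaves n - 1), S.blk * (2 * leaves n - 2)])) := by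
  have h := lt_leaves n
  have h1 : n + (leaves n - n) = leaves n := by omega
  have h2 : leaves n + (leaves n - 1) = 2 * leaves n - 1 := by omega
  have l1 := fun i (_ : i < n) => show
    (S.leafT.map (TGate.inst ![i, S.blk * i, 0])).length = S.blk by simp [length_leafT]
  have l2 := fun i (_ : i < leaves n - n) => show
    (S.unitT.map (TGate.inst ![n, S.blk * (n + i), 0])).length = S.blk by simp [length_unitT]
  have l3 := fun i (_ : i < leaves n - 1) => show
    (S.nodeT.map (TGate.inst ![n, S.blk * (leaves n + i), S.blk * (2 * i)])).length = S.blk by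
      simp [length_nodeT]
  simp only [circuit, idxAll_append, List.length_append, length_flatMap_range _ l1,
    length_flatMap_range _ l2, length_flatMap_range _ l3, idxAll_flatMap_range l1,
    idxAll_flatMap_range l2, idxAll_flatMap_range l3, and_assoc, Nat.zero_add, ← Nat.mul_add,
    h1, h2]

section Templates

variable {S} {ρ : Fin 3 → ℕ} {Q : ℕ → Gate → Prop}

theorem idxAll_leafT (hQ : Formula.Local (ρ 1) Q) (h : ∀ m, ρ 1 ≤ m → Q m (.input (ρ 0))) :
    IdxAll Q (ρ 1) (S.leafT.map (TGate.inst ρ)) :=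
  Formula.idxAll_block S.leaf_le hQ fun m _ hm => h m hm

theorem idxAll_unitT (hQ : Formula.Local (ρ 1) Q) :
    IdxAll Q (ρ 1) (S.unitT.map (TGate.inst ρ)) :=
  Formula.idxAll_block S.unit_le hQ fun _ a _ => a.elim

theorem idxAll_nodeT (hQ : Formula.Local (ρ 1) Q)
    (h : ∀ m a, ρ 1 ≤ m → Q m ((S.childGate a).inst ρ)) :
    IdxAll Q (ρ 1) (S.nodeT.map (TGate.inst ρ)) :=
  Formula.idxAll_block S.node_le hQ h

theorem idxAll_outT (hQ : Formula.Local (ρ 1) Q)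
    (h : ∀ m i, ρ 1 ≤ m → Q m ((S.childGate (false, i)).inst ρ)) :
    IdxAll Q (ρ 1) (S.outT.map (TGate.inst ρ)) :=
  Formula.idxAll_compile hQ h S.out 0

variable {x v : List Bool} {i : ℕ}

theorem getD_leafT (h : IdxAll (fun m g => v.getD m false = g.value x v) (ρ 1)
      (S.leafT.map (TGate.inst ρ))) (hi : i < S.width) :
    v.getD (ρ 1 + S.pos i) false = (S.leaf i).eval fun _ => x.getD (ρ 0) false :=
  Formula.getD_block S.leaf_le (fun _ => rfl) h hi

theorem getD_unitT (h : IdxAll (fun m g => v.getD m false = g.value x v) (ρ 1)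
      (S.unitT.map (TGate.inst ρ))) (hi : i < S.width) :
    v.getD (ρ 1 + S.pos i) false = (S.unit i).eval Empty.elim :=
  Formula.getD_block S.unit_le (fun a => a.elim) h hi

/-- The disjunction of a gate with itself is a copy, so every variable costs one gate inside the
block. -/
theorem childGate_value (a : Bool × Fin S.width) : ((S.childGate a).inst ρ).value x v
    = v.getD (ρ 2 + (if a.1 then S.blk else 0) + S.pos a.2) false := by
  simp only [childGate, TGate.inst, Gate.value, Bool.or_self, Nat.add_assoc]

theorem getD_nodeT (h : IdxAll (fun m g => v.getD m false = g.value x v) (ρ 1)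
      (S.nodeT.map (TGate.inst ρ))) (hi : i < S.width) :
    v.getD (ρ 1 + S.pos i) false = (S.node i).eval fun a =>
      v.getD (ρ 2 + (if a.1 then S.blk else 0) + S.pos a.2) false :=
  Formula.getD_block S.node_le childGate_value h hi

theorem getD_outT (h : IdxAll (fun m g => v.getD m false = g.value x v) (ρ 1)
      (S.outT.map (TGate.inst ρ))) :
    v.getD (ρ 1 + (S.out.size - 1)) false
      = S.out.eval fun i : Fin S.width => v.getD (ρ 2 + S.pos i) false := by
  have := Formula.getD_compile (A := 1) (fun i => childGate_value (false, i)) S.out 0 h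
  simpa using this

end Templates

theorem local_wellFormed (n base : ℕ) :
    Formula.Local base fun m g => Gate.WellFormed n m g where
  const _ _ := trivial
  not _ _ _ h := h
  and _ _ _ _ h1 _ h2 := ⟨h1, h2⟩
  or _ _ _ _ h1 _ h2 := ⟨h1, h2⟩

theorem childGate_wellFormed {n m : ℕ} {ρ : Fin 3 → ℕ} (a : Bool × Fin S.width)
    (h : ρ 2 + (if a.1 then S.blk else 0) + S.blk ≤ m) :
    ((S.childGate a).inst ρ).WellFormed n m := by
  have := S.pos_lt a.2.isLt
  simp only [childGate, TGate.inst, Gate.WellFormed]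
  omega

theorem idxAll_wellFormed (n : ℕ) : IdxAll (fun m g => g.WellFormed n m) 0 (S.circuit n) := by
  have hN := lt_leaves n
  rw [idxAll_circuit]
  refine ⟨fun j hj => ?_, fun j hj => ?_, fun c hc => ?_, ?_⟩
  · exact idxAll_leafT (ρ := ![j, S.blk * j, 0]) (local_wellFormed n _) fun m _ => hj
  · exact idxAll_unitT (ρ := ![n, S.blk * (n + j), 0]) (local_wellFormed n _)
  · refine idxAll_nodeT (ρ := ![n, S.blk * (leaves n + c), S.blk * (2 * c)])
      (local_wellFormed n _) fun m a hm => S.childGate_wellFormed a ?_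
    -- Since `c + 1` is less than the number of leaves, both children `2 * c` and `2 * c + 1`
    -- precede their parent.
    have h1 : S.blk * (2 * c + 2) ≤ S.blk * (leaves n + c) := Nat.mul_le_mul_left _ (by omega)
    rw [Nat.mul_add] at h1
    change S.blk * (leaves n + c) ≤ m at hm
    change S.blk * (2 * c) + _ + _ ≤ m
    split_ifs <;> omega
  · refine idxAll_outT
      (ρ := ![n, S.blk * (2 * leaves n - 1), S.blk * (2 * leaves n - 2)])
      (local_wellFormed n _) fun m a hm => S.childGate_wellFormed _ ?_
    have h1 : S.blk * (2 * leaves n - 1) = S.blk * (2 * leaves n - 2) + S.blk := by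
      rw [← Nat.mul_succ]; congr 1; omega
    change S.blk * (2 * leaves n - 1) ≤ m at hm
    change S.blk * (2 * leaves n - 2) + _ + _ ≤ m
    simp; omega

theorem circuit_wellFormed (n : ℕ) : (S.circuit n).WellFormed n := by
  refine ⟨fun h => ?_, fun m hm => ?_⟩
  · have h1 := S.length_circuit n
    have h2 := S.out.size_pos
    rw [h, List.length_nil] at h1
    omega
  · have := idxAll_iff.1 (S.idxAll_wellFormed n) m hm
    rwa [Nat.zero_add] at this

theorem childGate_depth {ρ : Fin 3 → ℕ} {d : List ℕ} {D : ℕ} (a : Bool × Fin S.width)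
    (h : ∀ i < S.blk, d.getD (ρ 2 + (if a.1 then S.blk else 0) + i) 0 ≤ D) :
    ((S.childGate a).inst ρ).depth d ≤ D + 1 := by
  have := h _ (S.pos_lt a.2.isLt)
  simp only [childGate, TGate.inst, Gate.depth, max_self, ← Nat.add_assoc]
  omega

/-- Heap numbering read backwards: with `N` leaves, block `2 * N - 1 - h` is heap node `h`. The root
is `h = 1`, the leaves have `h ≥ N`, and the children `2 * h + 1` (left) and `2 * h` (right) come
earlier in the circuit. A node at distance `K` from the root has height `l`, and every level costs
at most `S.blk` in depth. -/
theorem depth_block (n : ℕ) (l : ℕ) : ∀ K h, K + l = (n + 1).size → 2 ^ K ≤ h → h < 2 ^ (K + 1) →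
    ∀ i < S.blk, (Circuit.depths (S.circuit n)).getD (S.blk * (2 * leaves n - 1 - h) + i) 0
      ≤ S.blk * l + i := by
  obtain ⟨h1, h2, h3, -⟩ := S.idxAll_circuit.1
    (Circuit.idxAll_depths (S.idxAll_wellFormed n))
  have hN := lt_leaves n
  set d := Circuit.depths (S.circuit n)
  induction l with
  | zero =>
    intro K h hK hl hu i hi
    obtain rfl : K = (n + 1).size := hK
    rw [pow_succ] at hu
    change leaves n ≤ h at hl
    change h < leaves n * 2 at hu
    by_cases hj : 2 * leaves n - 1 - h < n
    · refine depth_le_of_idxAll (idxAll_leafT (ρ := ![2 * leaves n - 1 - h,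
        S.blk * (2 * leaves n - 1 - h), 0]) (local_depthStep _ _ _)
        fun m _ _ => by simp [Gate.depth]) (h1 _ hj) i ?_
      simpa using hi.trans_eq S.length_leafT.symm
    · have := h2 (2 * leaves n - 1 - h - n) (by omega)
      rw [Nat.add_sub_cancel' (by omega)] at this
      refine depth_le_of_idxAll (idxAll_unitT (ρ := ![n,
        S.blk * (2 * leaves n - 1 - h), 0]) (local_depthStep _ _ _)) this i ?_
      simpa using hi.trans_eq S.length_unitT.symm
  | succ l ih =>
    intro K h hK hl hu i hi
    have hle : 2 ^ (K + 1) ≤ leaves n := Nat.pow_le_pow_right (by omega) (by omega)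
    have hpos : 0 < 2 ^ K := by positivity
    rw [pow_succ] at hu
    have hb := h3 (leaves n - 1 - h) (by omega)
    rw [show leaves n + (leaves n - 1 - h) = 2 * leaves n - 1 - h by omega] at hb
    refine depth_le_of_idxAll (idxAll_nodeT (ρ := ![n, S.blk * (2 * leaves n - 1 - h),
        S.blk * (2 * (leaves n - 1 - h))]) (local_depthStep _ _ _)
        fun m a _ _ => ?_) hb i ?_
    · have hchild : ∀ i < S.blk, d.getD (S.blk * (2 * (leaves n - 1 - h))
          + (if a.1 then S.blk else 0) + i) 0 ≤ S.blk * l + S.blk - 1 := by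
        intro i hi
        by_cases ha : a.1
        · have := ih (K + 1) (2 * h) (by omega) (by rw [pow_succ]; omega)
            (by rw [pow_succ, pow_succ]; omega) i hi
          rw [show 2 * leaves n - 1 - 2 * h = 2 * (leaves n - 1 - h) + 1 by
              rw [pow_succ] at hle; omega,
            Nat.mul_succ] at this
          rw [if_pos ha]; omega
        · have := ih (K + 1) (2 * h + 1) (by omega) (by rw [pow_succ]; omega)
            (by rw [pow_succ, pow_succ]; omega) i hi
          rw [show 2 * leaves n - 1 - (2 * h + 1) = 2 * (leaves n - 1 - h) by omega] at this
          rw [if_neg ha, Nat.add_zero]; omega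
      have := S.childGate_depth (ρ := ![n, S.blk * (2 * leaves n - 1 - h),
        S.blk * (2 * (leaves n - 1 - h))]) a hchild
      rw [Nat.mul_succ]
      omega
    · simpa using hi.trans_eq S.length_nodeT.symm

theorem depth_circuit (n : ℕ) :
    (S.circuit n).depth ≤ S.blk * ((n + 1).size + 1) + S.out.size := by
  have hN := lt_leaves n
  have hblocks := S.depth_block n
  obtain ⟨-, -, -, h4⟩ := S.idxAll_circuit.1 (Circuit.idxAll_depths (S.idxAll_wellFormed n))
  refine Circuit.depth_le fun m hm => ?_
  set d := Circuit.depths (S.circuit n)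
  rw [length_circuit] at hm
  by_cases hmb : m < S.blk * (2 * leaves n - 1)
  · have hblk : 0 < S.blk := Nat.pos_of_mul_pos_right (by omega : 0 < S.blk * (2 * leaves n - 1))
    have hq : m / S.blk < 2 * leaves n - 1 := (Nat.div_lt_iff_lt_mul hblk).2 (by rwa [Nat.mul_comm])
    have hdm := Nat.div_add_mod m S.blk
    generalize m / S.blk = q at hq hdm
    have hh : 2 * leaves n - 1 - q ≠ 0 := by omega
    -- The distance of heap node `h` from the root is its binary logarithm.
    have hK : Nat.log 2 (2 * leaves n - 1 - q) ≤ (n + 1).size := by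
      rw [← Nat.lt_succ_iff]
      apply Nat.log_lt_of_lt_pow hh
      rw [pow_succ]
      change _ < leaves n * 2
      omega
    have := hblocks ((n + 1).size - Nat.log 2 (2 * leaves n - 1 - q)) _ _
      (by omega) (Nat.pow_log_le_self 2 hh) (Nat.lt_pow_succ_log_self (by omega) _)
      (m % S.blk) (Nat.mod_lt _ hblk)
    rw [show 2 * leaves n - 1 - (2 * leaves n - 1 - q) = q by omega, hdm] at this
    refine this.trans ?_
    have h1 := Nat.mod_lt m hblk
    have h2 : S.blk * ((n + 1).size - Nat.log 2 (2 * leaves n - 1 - q))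
      ≤ S.blk * (n + 1).size := Nat.mul_le_mul_left _ (by omega)
    rw [Nat.mul_succ]
    omega
  · have := depth_le_of_idxAll (D := S.blk * ((n + 1).size + 1)) (idxAll_outT
      (ρ := ![n, S.blk * (2 * leaves n - 1), S.blk * (2 * leaves n - 2)])
      (local_depthStep _ _ _) fun m a _ _ => ?_) h4 (m - S.blk * (2 * leaves n - 1)) ?_
    · change d.getD (S.blk * (2 * leaves n - 1) + (m - S.blk * (2 * leaves n - 1))) 0 ≤ _ at this
      rw [Nat.add_sub_cancel' (by omega)] at this
      omega
    · have hroot := hblocks (n + 1).size 0 1 (by omega) (by simp) (by simp)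
      rw [show 2 * leaves n - 1 - 1 = 2 * leaves n - 2 by omega] at hroot
      have := S.childGate_depth (ρ := ![n, S.blk * (2 * leaves n - 1), S.blk * (2 * leaves n - 2)])
        (false, a) (D := S.blk * (n + 1).size + S.blk - 1) (d := d) fun i hi => by
          have h1 := hroot i hi
          simp only [Bool.false_eq_true, if_false, Nat.add_zero]
          change d.getD (S.blk * (2 * leaves n - 2) + i) 0 ≤ _
          omega
      have hb := S.pos_lt a.isLt
      rw [Nat.mul_succ]
      omega
    · rw [List.length_map]
      rw [length_outT]
      omega

/-! ### Simulating an automaton -/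

/-- The formulas of the scheme compute with state maps of the automaton `M`, in the encoding
`enc`. -/
structure Computes {σ : Type} (M : DFA Bool σ) (enc : (σ → σ) → ℕ → Bool) : Prop where
  leaf : ∀ b, ∀ i < S.width, (S.leaf i).eval (fun _ => b) = enc (fun s => M.step s b) i
  unit : ∀ v, ∀ i < S.width, (S.unit i).eval v = enc id i
  node : ∀ f g, ∀ i < S.width,
    (S.node i).eval (fun a => if a.1 then enc g a.2 else enc f a.2) = enc (g ∘ f) i
  out : ∀ f, S.out.eval (fun i : Fin S.width => enc f i) = true ↔ f M.start ∈ M.accept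

variable {S}

/-- With `N` leaves, heap node `h` of height `l` covers the `2 ^ l` leaves from number `2 * N - (h +
1) * 2 ^ l` on. Beyond the end of `w` the segment is empty and acts as the identity, which is what
the `unit` leaves provide. -/
theorem Computes.value_block {σ : Type} {M : DFA Bool σ} {enc : (σ → σ) → ℕ → Bool}
    (hS : S.Computes M enc) (w : List Bool) (l : ℕ) : ∀ K h, K + l = (w.length + 1).size →
    2 ^ K ≤ h → h < 2 ^ (K + 1) → ∀ i < S.width,
      (Circuit.values w (S.circuit w.length)).getD
          (S.blk * (2 * leaves w.length - 1 - h) + S.pos i) false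
        = enc (fun s => M.evalFrom s
            ((w.drop (2 * leaves w.length - (h + 1) * 2 ^ l)).take (2 ^ l))) i := by
  obtain ⟨h1, h2, h3, -⟩ := S.idxAll_circuit.1
    (Circuit.idxAll_values w (S.idxAll_wellFormed w.length))
  have hN := lt_leaves w.length
  set v := Circuit.values w (S.circuit w.length)
  set N := leaves w.length with hNdef
  induction l with
  | zero =>
    intro K h hK hl hu i hi
    obtain rfl : K = (w.length + 1).size := hK
    rw [pow_succ] at hu
    change N ≤ h at hl
    change h < N * 2 at hu
    rw [pow_zero, Nat.mul_one, show 2 * N - (h + 1) = 2 * N - 1 - h by omega]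
    by_cases hj : 2 * N - 1 - h < w.length
    · rw [List.drop_eq_getElem_cons hj]
      refine (getD_leafT (ρ := ![2 * N - 1 - h, S.blk * (2 * N - 1 - h), 0]) (h1 _ hj) hi).trans ?_
      rw [hS.leaf _ i hi]
      change enc (fun s => M.step s (w.getD (2 * N - 1 - h) false)) i = _
      rw [List.getD_eq_getElem _ _ hj]
      rfl
    · have := h2 (2 * N - 1 - h - w.length) (by omega)
      rw [Nat.add_sub_cancel' (by omega)] at this
      rw [List.drop_eq_nil_of_le (by omega)]
      exact (getD_unitT (ρ := ![w.length, S.blk * (2 * N - 1 - h), 0]) this hi).trans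
        (hS.unit _ i hi)
  | succ l ih =>
    intro K h hK hl hu i hi
    have hle : 2 ^ (K + 1) ≤ N := Nat.pow_le_pow_right (by omega) (by omega)
    have hpos : 0 < 2 ^ K := by positivity
    have hNK : N = 2 ^ K * 2 ^ (l + 1) := by rw [hNdef, leaves, ← pow_add, hK]
    have hrange : (h + 1) * 2 ^ (l + 1) ≤ 2 * N := by
      rw [hNK, ← Nat.mul_assoc, Nat.mul_comm 2, ← pow_succ]
      exact Nat.mul_le_mul_right _ hu
    rw [pow_succ] at hu
    have hb := h3 (N - 1 - h) (by omega)
    rw [show N + (N - 1 - h) = 2 * N - 1 - h by omega] at hb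
    have e1 : 2 * N - (2 * h + 1 + 1) * 2 ^ l = 2 * N - (h + 1) * 2 ^ (l + 1) := by
      congr 1; ring
    have e2 : 2 * N - (2 * h + 1) * 2 ^ l = 2 * N - (h + 1) * 2 ^ (l + 1) + 2 ^ l := by
      have : (h + 1) * 2 ^ (l + 1) = (2 * h + 1) * 2 ^ l + 2 ^ l := by ring
      rw [this] at hrange ⊢
      generalize (2 * h + 1) * 2 ^ l = z at hrange ⊢
      generalize 2 ^ l = q at hrange ⊢
      clear e1 hNK
      omega
    -- The left child `2 * h + 1` covers the first half of the segment and the right child `2 * h`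
    -- the second.
    have hsplit : ∀ s, M.evalFrom s
          ((w.drop (2 * N - (h + 1) * 2 ^ (l + 1))).take (2 ^ (l + 1)))
        = M.evalFrom (M.evalFrom s ((w.drop (2 * N - (2 * h + 1 + 1) * 2 ^ l)).take (2 ^ l)))
            ((w.drop (2 * N - (2 * h + 1) * 2 ^ l)).take (2 ^ l)) := by
      intro s
      rw [e1, e2, ← DFA.evalFrom_of_append, ← List.drop_drop, ← List.take_add, pow_succ,
        Nat.mul_two]
    rw [funext hsplit]
    refine (getD_nodeT (ρ := ![w.length, S.blk * (2 * N - 1 - h), S.blk * (2 * (N - 1 - h))])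
      hb hi).trans (Eq.trans ?_ (hS.node
        (fun s => M.evalFrom s ((w.drop (2 * N - (2 * h + 1 + 1) * 2 ^ l)).take (2 ^ l)))
        (fun s => M.evalFrom s ((w.drop (2 * N - (2 * h + 1) * 2 ^ l)).take (2 ^ l))) i hi))
    congr 1
    funext a
    change v.getD (S.blk * (2 * (N - 1 - h)) + _ + _) false = _
    by_cases ha : a.1
    · have := ih (K + 1) (2 * h) (by omega) (by rw [pow_succ]; omega)
        (by rw [pow_succ, pow_succ]; omega) a.2 a.2.isLt
      rw [show 2 * N - 1 - 2 * h = 2 * (N - 1 - h) + 1 by rw [pow_succ] at hle; omega,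
        Nat.mul_succ] at this
      rw [if_pos ha, if_pos ha]
      exact this
    · have := ih (K + 1) (2 * h + 1) (by omega) (by rw [pow_succ]; omega)
        (by rw [pow_succ, pow_succ]; omega) a.2 a.2.isLt
      rw [show 2 * N - 1 - (2 * h + 1) = 2 * (N - 1 - h) by omega] at this
      rw [if_neg ha, if_neg ha]
      exact this

/-- The segment of the root starts at `0` and is longer than the input, so its map is that of the
whole word. -/
theorem Computes.eval_circuit {σ : Type} {M : DFA Bool σ} {enc : (σ → σ) → ℕ → Bool}
    (hS : S.Computes M enc) (w : List Bool) :
    (S.circuit w.length).eval w = true ↔ w ∈ M.accepts := by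
  have hN := lt_leaves w.length
  have hroot := hS.value_block w (w.length + 1).size 0 1 (by omega) (by simp) (by simp)
  obtain ⟨-, -, -, h4⟩ := S.idxAll_circuit.1
    (Circuit.idxAll_values w (S.idxAll_wellFormed w.length))
  have hout := getD_outT
    (ρ := ![w.length, S.blk * (2 * leaves w.length - 1), S.blk * (2 * leaves w.length - 2)]) h4
  have e1 : 2 * leaves w.length - (1 + 1) * 2 ^ (w.length + 1).size = 0 := by
    change 2 * leaves w.length - (1 + 1) * leaves w.length = 0
    omega
  rw [e1, List.drop_zero, List.take_of_length_le
      (show w.length ≤ 2 ^ (w.length + 1).size from (Nat.lt_of_succ_lt hN).le),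
    show 2 * leaves w.length - 1 - 1 = 2 * leaves w.length - 2 by omega] at hroot
  rw [Circuit.eval_eq, length_circuit, Nat.add_sub_assoc S.out.size_pos, DFA.mem_accepts]
  refine Iff.trans (Eq.congr (hout.trans ?_) rfl) (hS.out fun s => M.evalFrom s w)
  congr 1
  funext i
  exact hroot i i.isLt

/-- Every automaton has a scheme. -/
theorem exists_computes {σ : Type} [Finite σ] (M : DFA Bool σ) :
    ∃ (S : Scheme) (enc : (σ → σ) → ℕ → Bool), S.Computes M enc := by
  classical
  obtain ⟨W, ⟨e⟩⟩ := Finite.exists_equiv_fin (σ → σ)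
  -- One bit for each of the finitely many state maps; the later steps need only that this code is
  -- injective.
  let enc : (σ → σ) → ℕ → Bool := fun f i => decide ((e f : ℕ) = i)
  let res : (σ → σ) → Fin W → Bool := fun f i => enc f i
  have hinj : Function.Injective res := by
    intro f g hfg
    have := congrFun hfg (e f)
    simp only [res, enc, decide_true] at this
    exact (e.injective (Fin.ext (by simpa using this.symm))).symm
  have : Nonempty (σ → σ) := ⟨id⟩
  let dec : (Fin W → Bool) → (σ → σ) := Function.invFun res
  have hdec : ∀ f, dec (res f) = f := Function.leftInverse_invFun hinj
  choose leaf hleaf using fun i : ℕ => Formula.exists_eval_eq (α := Unit)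
    fun v => enc (fun s => M.step s (v ())) i
  choose unit hunit using fun i : ℕ => Formula.exists_eval_eq (α := Empty) fun _ => enc id i
  choose node hnode using fun i : ℕ => Formula.exists_eval_eq (α := Bool × Fin W)
    fun v => enc (dec (fun j => v (true, j)) ∘ dec (fun j => v (false, j))) i
  obtain ⟨out, hout⟩ := Formula.exists_eval_eq (α := Fin W)
    fun v => decide (dec v M.start ∈ M.accept)
  -- The sum over the finitely many results bounds every formula in use.
  let cell : ℕ := ∑ i ∈ Finset.range W, ((leaf i).size + (unit i).size + (node i).size)
  have hcell : ∀ i < W, (leaf i).size + (unit i).size + (node i).size ≤ cell := fun i hi =>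
    Finset.single_le_sum (f := fun i => (leaf i).size + (unit i).size + (node i).size)
      (fun _ _ => Nat.zero_le _) (Finset.mem_range.2 hi)
  refine ⟨⟨W, cell, leaf, unit, node, out, fun i hi => ?_, fun i hi => ?_, fun i hi => ?_⟩, enc,
    ⟨fun b i _ => hleaf i _, fun v i _ => hunit i v, fun f g i _ => ?_, fun f => ?_⟩⟩
  · have := hcell i hi; omega
  · have := hcell i hi; omega
  · have := hcell i hi; omega
  · change (node i).eval _ = _
    rw [hnode]
    have h1 := hdec f
    have h2 := hdec g
    simp only [res] at h1 h2
    simp only [if_true, Bool.false_eq_true, if_false]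
    rw [h1, h2]
  · change out.eval (res f) = true ↔ _
    rw [hout, hdec, decide_eq_true_iff]

end Scheme

end Circ


/-! ### Logarithmic-space uniformity -/

namespace TM

variable {k : ℕ} {B : ℕ}

/-- The program that runs `P` a fixed number of times. -/
def Prog.rep (P : Prog k) : ℕ → Prog k
  | 0 => .skip
  | m + 1 => .seq P (P.rep m)

theorem Exec.of_eq {P : Prog k} {ρ ρ' ρ'' : Fin k → ℕ} {o o' : List Bool} (h : Exec B P ρ ρ' o)
    (hρ : ρ' = ρ'') (ho : o = o') : Exec B P ρ ρ'' o' := hρ ▸ ho ▸ h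

/-- `ρ i` is the content of the registers before round `i`. The body may change the loop register
itself, so the number `m` of rounds need not be its initial content; the doubling loop of `setup`
relies on this. -/
theorem Exec.loop {r : Fin k} {P : Prog k} {σ σ' : Fin k → ℕ} (m : ℕ) (ρ : ℕ → Fin k → ℕ)
    (o : ℕ → List Bool) (h0 : σ = ρ 0) (hm : ρ m = σ') (hr : ∀ i < m, ρ i r ≠ 0) (hz : σ' r = 0)
    (h : ∀ i < m, Exec B P (Function.update (ρ i) r (ρ i r - 1)) (ρ (i + 1)) (o i)) :
    Exec B (.loop r P) σ σ' ((List.range m).flatMap o) := by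
  induction m generalizing ρ o σ with
  | zero => rw [h0, hm]; exact Exec.loop_zero hz
  | succ m ih =>
    rw [List.range_succ_eq_map, List.flatMap_cons, List.flatMap_map, h0]
    exact Exec.loop_succ (hr 0 (by omega)) (h 0 (by omega))
      (ih (fun i => ρ (i + 1)) (fun i => o (i + 1)) rfl hm (fun i hi => hr _ (by omega))
        (fun i hi => h _ (by omega)))

theorem Exec.loop_silent {r : Fin k} {P : Prog k} {σ σ' : Fin k → ℕ} (m : ℕ) (ρ : ℕ → Fin k → ℕ)
    (h0 : σ = ρ 0) (hm : ρ m = σ') (hr : ∀ i < m, ρ i r ≠ 0) (hz : σ' r = 0)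
    (h : ∀ i < m, Exec B P (Function.update (ρ i) r (ρ i r - 1)) (ρ (i + 1)) []) :
    Exec B (.loop r P) σ σ' [] :=
  (Exec.loop m ρ (fun _ => []) h0 hm hr hz h).of_eq rfl (by simp)

theorem Exec.seq_silent {P Q : Prog k} {ρ ρ' ρ'' : Fin k → ℕ} {o : List Bool}
    (h : Exec B P ρ ρ' []) (h' : Exec B Q ρ' ρ'' o) : Exec B (.seq P Q) ρ ρ'' o :=
  Exec.seq h h'

theorem Exec.rep_emit (b : Bool) (m : ℕ) (ρ : Fin k → ℕ) :
    Exec B ((Prog.emit b).rep m) ρ ρ (List.replicate m b) := by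
  induction m with
  | zero => exact Exec.skip ρ
  | succ m ih => exact Exec.seq (Exec.emit b ρ) ih

theorem Exec.rep_inc (r : Fin k) (m : ℕ) (ρ : Fin k → ℕ) (h : ρ r + m ≤ B) :
    Exec B ((Prog.inc r).rep m) ρ (Function.update ρ r (ρ r + m)) [] := by
  induction m generalizing ρ with
  | zero => exact (Exec.skip ρ).of_eq (by simp) rfl
  | succ m ih =>
    refine (Exec.seq_silent (Exec.inc r ρ (by omega)) (ih _ ?_)).of_eq ?_ rfl
    · simp; omega
    · simp [Nat.add_assoc, Nat.add_comm 1]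

/-- Output the unary code of a constant. -/
def emitUnary (m : ℕ) : Prog k := .seq ((Prog.emit true).rep m) (.emit false)

theorem Exec.emitUnary (m : ℕ) (ρ : Fin k → ℕ) :
    Exec B (emitUnary m) ρ ρ (KSPM.unary m) :=
  Exec.seq (Exec.rep_emit true m ρ) (Exec.emit false ρ)

/-- Output the unary code of `m` plus the content of register `r`, using register `t`. -/
def emitSum (t r : Fin k) (m : ℕ) : Prog k :=
  .seq (.loop r (.seq (.emit true) (.inc t))) (.seq (.loop t (.inc r)) (emitUnary m))

/-- A loop consumes its counter, so `r` is moved to `t` while the ones are printed and then moved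
back. -/
theorem Exec.emitSum {t r : Fin k} (htr : t ≠ r) (m : ℕ) {ρ : Fin k → ℕ} (ht : ρ t = 0)
    (hB : ρ r ≤ B) : Exec B (emitSum t r m) ρ ρ (KSPM.unary (ρ r + m)) := by
  have h1 : Exec B (.loop r (.seq (.emit true) (.inc t))) ρ
      (Function.update (Function.update ρ r 0) t (ρ r))
      ((List.range (ρ r)).flatMap fun _ => [true]) := by
    refine Exec.loop (ρ r) (fun i => Function.update (Function.update ρ r (ρ r - i)) t i) _
      (by simp only [Nat.sub_zero, Function.update_eq_self]; rw [← ht, Function.update_eq_self])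
      (by simp) (fun i hi => by simp [htr.symm]; omega) (by simp [htr.symm])
      fun i hi => ?_
    refine (Exec.seq (Exec.emit true _) (Exec.inc t _ ?_)).of_eq ?_ rfl
    · simp [htr]; omega
    · funext j
      by_cases hj : j = t
      · subst hj; simp [htr]
      · by_cases hj' : j = r
        · subst hj'; simp [hj]; omega
        · simp [hj, hj']
  have h2 : Exec B (.loop t (.inc r)) (Function.update (Function.update ρ r 0) t (ρ r)) ρ [] := by
    refine Exec.loop_silent (ρ r) (fun i => Function.update (Function.update ρ r i) t (ρ r - i))
      (by simp) (by simp [← ht]) (fun i hi => by simp; omega) ht fun i hi => ?_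
    refine (Exec.inc r _ ?_).of_eq ?_ rfl
    · simp [htr.symm]; omega
    · funext j
      by_cases hj : j = t
      · subst hj; simp [htr]; omega
      · by_cases hj' : j = r
        · subst hj'; simp [hj]
        · simp [hj, hj']
  refine (Exec.seq h1 (Exec.seq_silent h2 (Exec.emitUnary m ρ))).of_eq rfl ?_
  have : ∀ c : ℕ, ((List.range c).flatMap fun _ => [true]) = List.replicate c true := by
    intro c
    induction c with
    | zero => rfl
    | succ c ih => rw [List.range_succ, List.flatMap_append, ih]; simp [List.replicate_succ']
  rw [this, KSPM.unary, KSPM.unary, ← List.append_assoc, List.replicate_append_replicate]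

/-! ### Printing the gates of a template -/

/-- The registers for the bases of the templates are the first three of nine. -/
def baseReg (r : Fin 3) : Fin 9 := r.castLE (by omega)

theorem three_ne_baseReg (r : Fin 3) : (3 : Fin 9) ≠ baseReg r := by
  fin_cases r <;> decide

/-- Output the code of a gate. -/
def emitGate : Circ.TGate (Fin 3) → Prog 9
  | .input r => .seq (emitUnary 0) (emitSum 3 (baseReg r) 0)
  | .const b => .seq (emitUnary 1) (emitUnary b.toNat)
  | .not a => .seq (emitUnary 2) (emitSum 3 (baseReg a.1) a.2)
  | .and a b => .seq (.seq (emitUnary 3) (emitSum 3 (baseReg a.1) a.2))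
      (emitSum 3 (baseReg b.1) b.2)
  | .or a b => .seq (.seq (emitUnary 4) (emitSum 3 (baseReg a.1) a.2))
      (emitSum 3 (baseReg b.1) b.2)

theorem Exec.emitGate {ρ : Fin 9 → ℕ} (h3 : ρ 3 = 0) (hB : ∀ r, ρ (baseReg r) ≤ B)
    (g : Circ.TGate (Fin 3)) :
    Exec B (emitGate g) ρ ρ (g.inst fun r => ρ (baseReg r)).encode := by
  have hs := fun r m => Exec.emitSum (three_ne_baseReg r) m h3 (hB r)
  cases g with
  | input r => exact Exec.seq (Exec.emitUnary _ _) (hs _ _)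
  | const b => exact Exec.seq (Exec.emitUnary _ _) (Exec.emitUnary _ _)
  | not a => exact Exec.seq (Exec.emitUnary _ _) (hs _ _)
  | and a b => exact Exec.seq (Exec.seq (Exec.emitUnary _ _) (hs _ _)) (hs _ _)
  | or a b => exact Exec.seq (Exec.seq (Exec.emitUnary _ _) (hs _ _)) (hs _ _)

/-- Output the code of a list of gates. -/
def emitGates : List (Circ.TGate (Fin 3)) → Prog 9
  | [] => .skip
  | g :: l => .seq (emitGate g) (emitGates l)

/-- The registers. -/
def regs (x a l t y d n v c : ℕ) : Fin 9 → ℕ := ![x, a, l, t, y, d, n, v, c]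

section Regs

variable (x a l t y d n v c z : ℕ)

theorem regs_baseReg : (fun r => regs x a l t y d n v c (baseReg r)) = ![x, a, l] := by
  funext r; fin_cases r <;> rfl

theorem update_regs_zero : Function.update (regs x a l t y d n v c) 0 z
    = regs z a l t y d n v c := by funext i; fin_cases i <;> rfl

theorem update_regs_one : Function.update (regs x a l t y d n v c) 1 z
    = regs x z l t y d n v c := by funext i; fin_cases i <;> rfl

theorem update_regs_two : Function.update (regs x a l t y d n v c) 2 z
    = regs x a z t y d n v c := by funext i; fin_cases i <;> rfl

theorem update_regs_four : Function.update (regs x a l t y d n v c) 4 z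
    = regs x a l t z d n v c := by funext i; fin_cases i <;> rfl

theorem update_regs_five : Function.update (regs x a l t y d n v c) 5 z
    = regs x a l t y z n v c := by funext i; fin_cases i <;> rfl

theorem update_regs_six : Function.update (regs x a l t y d n v c) 6 z
    = regs x a l t y d z v c := by funext i; fin_cases i <;> rfl

theorem update_regs_seven : Function.update (regs x a l t y d n v c) 7 z
    = regs x a l t y d n z c := by funext i; fin_cases i <;> rfl

theorem update_regs_eight : Function.update (regs x a l t y d n v c) 8 z
    = regs x a l t y d n v z := by funext i; fin_cases i <;> rfl

variable {x a l t y d n v c}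

theorem Exec.inc_zero (h : x + 1 ≤ B) : Exec B (.inc 0) (regs x a l t y d n v c)
    (regs (x + 1) a l t y d n v c) [] :=
  (Exec.inc 0 _ h).of_eq (update_regs_zero ..) rfl

theorem Exec.rep_inc_one {m : ℕ} (h : a + m ≤ B) : Exec B ((Prog.inc 1).rep m)
    (regs x a l t y d n v c) (regs x (a + m) l t y d n v c) [] :=
  (Exec.rep_inc 1 m _ h).of_eq (update_regs_one ..) rfl

theorem Exec.rep_inc_two {m : ℕ} (h : l + m ≤ B) : Exec B ((Prog.inc 2).rep m)
    (regs x a l t y d n v c) (regs x a (l + m) t y d n v c) [] :=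
  (Exec.rep_inc 2 m _ h).of_eq (update_regs_two ..) rfl

theorem Exec.inc_five (h : d + 1 ≤ B) : Exec B (.inc 5) (regs x a l t y d n v c)
    (regs x a l t y (d + 1) n v c) [] :=
  (Exec.inc 5 _ h).of_eq (update_regs_five ..) rfl

theorem Exec.pred_five : Exec B (.pred 5) (regs x a l t y d n v c)
    (regs x a l t y (d - 1) n v c) [] :=
  (Exec.pred 5 _).of_eq (update_regs_five ..) rfl

theorem Exec.inc_six (h : n + 1 ≤ B) : Exec B (.inc 6) (regs x a l t y d n v c)
    (regs x a l t y d (n + 1) v c) [] :=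
  (Exec.inc 6 _ h).of_eq (update_regs_six ..) rfl

theorem Exec.inc_seven (h : v + 1 ≤ B) : Exec B (.inc 7) (regs x a l t y d n v c)
    (regs x a l t y d n (v + 1) c) [] :=
  (Exec.inc 7 _ h).of_eq (update_regs_seven ..) rfl

theorem Exec.pred_seven : Exec B (.pred 7) (regs x a l t y d n v c)
    (regs x a l t y d n (v - 1) c) [] :=
  (Exec.pred 7 _).of_eq (update_regs_seven ..) rfl

theorem Exec.inc_eight (h : c + 1 ≤ B) : Exec B (.inc 8) (regs x a l t y d n v c)
    (regs x a l t y d n v (c + 1)) [] :=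
  (Exec.inc 8 _ h).of_eq (update_regs_eight ..) rfl

theorem Exec.pred_eight : Exec B (.pred 8) (regs x a l t y d n v c)
    (regs x a l t y d n v (c - 1)) [] :=
  (Exec.pred 8 _).of_eq (update_regs_eight ..) rfl

theorem Exec.emitGates (hx : x ≤ B) (ha : a ≤ B) (hl : l ≤ B) (T : List (Circ.TGate (Fin 3))) :
    Exec B (emitGates T) (regs x a l 0 y d n v c) (regs x a l 0 y d n v c)
      ((T.map (Circ.TGate.inst ![x, a, l])).flatMap Circ.Gate.encode) := by
  induction T with
  | nil => exact Exec.skip _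
  | cons g T ih =>
    rw [List.map_cons, List.flatMap_cons, ← regs_baseReg x a l 0 y d n v c] at *
    refine Exec.seq (Exec.emitGate rfl (fun r => ?_) g) ih
    fin_cases r
    · exact hx
    · exact ha
    · exact hl

end Regs

/-! ### Computing the number of leaves -/

/-- Double register `6` and subtract its former content from register `5`, increased by one. -/
def doubleBody : Prog 9 :=
  .seq (.inc 5) (.seq (.loop 6 (.seq (.inc 7) (.seq (.inc 7) (.pred 5)))) (.loop 7 (.inc 6)))

/-- The first increment of register `5` makes up for the decrement by the surrounding loop. -/
theorem Exec.doubleBody {x a l t y d n c : ℕ} (hd : d + 1 ≤ B) (hn : 2 * n ≤ B) :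
    Exec B doubleBody (regs x a l t y d n 0 c) (regs x a l t y (d + 1 - n) (2 * n) 0 c) [] := by
  refine Exec.seq_silent (Exec.inc_five hd) (Exec.seq_silent
    (ρ' := regs x a l t y (d + 1 - n) 0 (2 * n) c) ?_ ?_)
  · refine Exec.loop_silent n (fun i => regs x a l t y (d + 1 - i) (n - i) (2 * i) c) rfl
      (by simp) (fun i hi => (by omega : n - i ≠ 0)) rfl fun i hi => ?_
    rw [update_regs_six]
    refine Exec.seq_silent (Exec.inc_seven (by omega)) (Exec.seq_silent
      (Exec.inc_seven (by omega)) (Exec.pred_five.of_eq ?_ rfl))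
    rfl
  · refine Exec.loop_silent (2 * n) (fun i => regs x a l t y (d + 1 - n) i (2 * n - i) c) rfl
      (by simp) (fun i hi => (by omega : 2 * n - i ≠ 0)) rfl fun i hi => ?_
    rw [update_regs_seven]
    exact Exec.inc_six (by omega)

/-- From `n + 1` in register `4`, compute `n` in register `8`, the number `N` of leaves in register
`5`, and `N - 1` in register `7`. -/
def setup : Prog 9 :=
  .seq (.loop 4 (.seq (.inc 5) (.inc 8))) <| .seq (.inc 6) <| .seq (.loop 5 doubleBody) <|
    .seq (.loop 6 (.seq (.inc 5) (.inc 7))) <| .seq (.pred 7) (.pred 8)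

theorem Exec.setup {n : ℕ} (hB : 2 * Circ.Scheme.leaves n ≤ B) :
    Exec B setup (regs 0 0 0 0 (n + 1) 0 0 0 0)
      (regs 0 0 0 0 0 (Circ.Scheme.leaves n) 0 (Circ.Scheme.leaves n - 1) n) [] := by
  have hN := Circ.Scheme.lt_leaves n
  refine Exec.seq_silent (ρ' := regs 0 0 0 0 0 (n + 1) 0 0 (n + 1)) ?_ <|
    Exec.seq_silent (Exec.inc_six (by omega)) <|
    Exec.seq_silent (ρ' := regs 0 0 0 0 0 0 (Circ.Scheme.leaves n) 0 (n + 1)) ?_ <|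
    Exec.seq_silent (ρ' := regs 0 0 0 0 0 (Circ.Scheme.leaves n) 0 (Circ.Scheme.leaves n) (n + 1))
      ?_ <| Exec.seq_silent Exec.pred_seven Exec.pred_eight
  · refine Exec.loop_silent (n + 1) (fun i => regs 0 0 0 0 (n + 1 - i) i 0 0 i) rfl
      (by simp) (fun i hi => (by omega : n + 1 - i ≠ 0)) rfl fun i hi => ?_
    rw [update_regs_four]
    exact Exec.seq_silent (Exec.inc_five (by omega)) (Exec.inc_eight (by omega))
  -- Before round `i` register `6` holds `2 ^ i` and register `5` holds `n + 2 - 2 ^ i`. The latter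
  -- is non-zero exactly as long as `2 ^ i ≤ n + 1`, that is `i < (n + 1).size`.
  · refine Exec.loop_silent (n + 1).size
      (fun i => regs 0 0 0 0 0 (n + 2 - 2 ^ i) (2 ^ i) 0 (n + 1)) rfl ?_ (fun i hi => ?_) rfl
      fun i hi => ?_
    · change regs 0 0 0 0 0 (n + 2 - Circ.Scheme.leaves n) (Circ.Scheme.leaves n) 0 (n + 1) = _
      rw [Nat.sub_eq_zero_of_le (by omega)]
    · have := Nat.lt_size.1 hi
      exact (by omega : n + 2 - 2 ^ i ≠ 0)
    · have h1 := Nat.lt_size.1 hi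
      have h2 : 2 ^ (i + 1) ≤ Circ.Scheme.leaves n := Nat.pow_le_pow_right (by omega) hi
      rw [update_regs_five]
      rw [pow_succ] at h2
      change Exec B TM.doubleBody (regs 0 0 0 0 0 (n + 2 - 2 ^ i - 1) _ _ _) _ _
      refine (Exec.doubleBody (by omega) (by omega)).of_eq ?_ rfl
      congr 1
      · rw [pow_succ]; omega
      · rw [pow_succ, Nat.mul_comm]
  · refine Exec.loop_silent (Circ.Scheme.leaves n)
      (fun i => regs 0 0 0 0 0 i (Circ.Scheme.leaves n - i) i (n + 1)) rfl
      (by simp) (fun i hi => (by omega : Circ.Scheme.leaves n - i ≠ 0)) rfl fun i hi => ?_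
    rw [update_regs_six]
    exact Exec.seq_silent (Exec.inc_five (by omega)) (Exec.inc_seven (by omega))

/-! ### Printing the circuit -/

/-- Output the description of the circuit. -/
def emitCircuit (S : Circ.Scheme) : Prog 9 :=
  .seq setup <|
  .seq (.loop 8 (.seq (.pred 5) (.seq (emitGates S.leafT)
    (.seq (.inc 0) ((Prog.inc 1).rep S.blk))))) <|
  .seq (.loop 5 (.seq (emitGates S.unitT) ((Prog.inc 1).rep S.blk))) <|
  .seq (.loop 7 (.seq (emitGates S.nodeT)
    (.seq ((Prog.inc 1).rep S.blk) ((Prog.inc 2).rep (2 * S.blk))))) <|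
  emitGates S.outT

/-- Block positions are linear in the loop counters, so each round adds constants to the base
registers. These stay below `S.blk` times twice the number of leaves, and the other registers below
twice that number, whence the bound `B`. -/
theorem Exec.emitCircuit (S : Circ.Scheme) {n : ℕ}
    (hB : (S.blk + 1) * (2 * Circ.Scheme.leaves n) ≤ B) :
    ∃ ρ', Exec B (emitCircuit S) (regs 0 0 0 0 (n + 1) 0 0 0 0) ρ' (S.circuit n).encode := by
  have hN := Circ.Scheme.lt_leaves n
  set N := Circ.Scheme.leaves n with hNdef
  have hb : ∀ q, q ≤ 2 * N → S.blk * q + 2 * N ≤ B := fun q hq => by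
    have := Nat.mul_le_mul_left S.blk hq
    rw [Nat.succ_mul] at hB
    omega
  have h0 := hb 0 (by omega)
  rw [Nat.mul_zero] at h0
  refine ⟨regs n (S.blk * (2 * N - 1)) (S.blk * (2 * N - 2)) 0 0 0 0 0 0, ?_⟩
  rw [Circ.Circuit.encode, Circ.Scheme.circuit, List.flatMap_append, List.flatMap_append,
    List.flatMap_append, List.flatMap_assoc, List.flatMap_assoc, List.flatMap_assoc,
    List.append_assoc, List.append_assoc]
  refine Exec.seq_silent (Exec.setup (by omega)) <|
    Exec.seq (ρ' := regs n (S.blk * n) 0 0 0 (N - n) 0 (N - 1) 0) ?_ <|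
    Exec.seq (ρ' := regs n (S.blk * N) 0 0 0 0 0 (N - 1) 0) ?_ <|
    Exec.seq (ρ' := regs n (S.blk * (2 * N - 1)) (S.blk * (2 * N - 2)) 0 0 0 0 0 0) ?_ ?_
  · refine Exec.loop n (fun i => regs i (S.blk * i) 0 0 0 (N - i) 0 (N - 1) (n - i)) _ rfl
      (by simp) (fun i hi => (by omega : n - i ≠ 0)) rfl fun i hi => ?_
    have := hb (i + 1) (by omega)
    have e := Nat.mul_add_one S.blk i
    rw [update_regs_eight]
    refine Exec.seq_silent Exec.pred_five <| (Exec.seq (Exec.emitGates (by omega) (by omega)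
      (by omega) S.leafT) <| Exec.seq_silent (Exec.inc_zero (by omega))
      (Exec.rep_inc_one (by omega))).of_eq rfl (List.append_nil _)
  · refine Exec.loop (N - n)
      (fun j => regs n (S.blk * (n + j)) 0 0 0 (N - n - j) 0 (N - 1) 0) _ rfl
      (by simp [Nat.add_sub_cancel' (show n ≤ N by omega)])
      (fun i hi => (by omega : N - n - i ≠ 0)) rfl fun i hi => ?_
    have := hb (n + i + 1) (by omega)
    have e := Nat.mul_add_one S.blk (n + i)
    rw [update_regs_five]
    exact (Exec.seq (Exec.emitGates (by omega) (by omega) (by omega) S.unitT)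
      (Exec.rep_inc_one (by omega))).of_eq rfl (List.append_nil _)
  · refine Exec.loop (N - 1)
      (fun c => regs n (S.blk * (N + c)) (S.blk * (2 * c)) 0 0 0 0 (N - 1 - c) 0) _ rfl
      ?_ (fun i hi => (by omega : N - 1 - i ≠ 0)) rfl fun i hi => ?_
    · rw [show N + (N - 1) = 2 * N - 1 by omega, show 2 * (N - 1) = 2 * N - 2 by omega,
        Nat.sub_self]
    have h1 := hb (N + i + 1) (by omega)
    have h2 := hb (2 * i + 2) (by omega)
    have e1 := Nat.mul_add_one S.blk (N + i)
    have e2 : S.blk * (2 * (i + 1)) = S.blk * (2 * i) + 2 * S.blk := by ring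
    have e3 : S.blk * (2 * i + 2) = S.blk * (2 * i) + 2 * S.blk := by ring
    rw [update_regs_seven]
    refine (Exec.seq (Exec.emitGates (by omega) (by omega) (by omega) S.nodeT)
      (Exec.seq_silent (Exec.rep_inc_one (by omega)) (Exec.rep_inc_two (by omega)))).of_eq ?_
      (List.append_nil _)
    rw [e2]
    rfl
  · have h1 := hb (2 * N - 1) (by omega)
    have h2 := hb (2 * N - 2) (by omega)
    exact Exec.emitGates (by omega) (by omega) (by omega) S.outT

theorem Machine.ComputesInSpace.mono {M : Machine} {w o : List Bool} {s s' : ℕ}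
    (h : M.ComputesInSpace w o s) (hs : s ≤ s') : M.ComputesInSpace w o s' :=
  ⟨h.1, fun c hc t => (h.2 c hc t).trans_le hs⟩

end TM

/-! ### From regular languages to the theorem -/

theorem size_succ_le_log (n : ℕ) : (n + 1).size ≤ Nat.log 2 n + 2 := by
  rw [Nat.size_le]
  have := Nat.lt_pow_succ_log_self (b := 2) (by omega) n
  rw [pow_succ]
  have h2 : 0 < 2 ^ (Nat.log 2 n + 1) := by positivity
  omega

theorem logspaceUniform_circuit (S : Circ.Scheme) : LogspaceUniform S.circuit := by
  refine ⟨(TM.Prog.seq (.load 4) (TM.emitCircuit S)).machine, S.blk + 8, fun n => ?_⟩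
  obtain ⟨ρ', hρ'⟩ := TM.Exec.emitCircuit S (n := n) le_rfl
  have hN := Circ.Scheme.lt_leaves n
  have hstart : Function.update (fun _ => 0) 4 ((List.replicate n true).length + 1)
      = TM.regs 0 0 0 0 (n + 1) 0 0 0 0 := by
    funext i; fin_cases i <;> simp [TM.regs, Function.update]
  rw [← hstart] at hρ'
  refine (TM.Exec.computesInSpace 4 hρ' ?_).mono ?_
  · rw [List.length_replicate, Nat.succ_mul]
    omega
  · have hsize : ((S.blk + 1) * (2 * Circ.Scheme.leaves n)).size ≤ S.blk + (Nat.log 2 n + 5) := by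
      rw [Nat.size_le, pow_add]
      have h1 : S.blk + 1 ≤ 2 ^ S.blk := Nat.lt_two_pow_self
      have h2 : 2 * Circ.Scheme.leaves n < 2 ^ (Nat.log 2 n + 5) := by
        rw [Circ.Scheme.leaves, ← Nat.pow_succ']
        have := size_succ_le_log n
        exact Nat.pow_lt_pow_right (by omega) (by omega)
      exact Nat.mul_lt_mul_of_le_of_lt h1 h2 (by positivity)
    have : Nat.log 2 n ≤ (S.blk + 8) * Nat.log 2 n := Nat.le_mul_of_pos_left _ (by omega)
    omega

/-- Regular languages are in logarithmic-space uniform NC¹. -/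
theorem Language.IsRegular.inNC1 {L : Language Bool} (hL : L.IsRegular) : InNC1 L := by
  obtain ⟨σ, _, M, rfl⟩ := hL
  obtain ⟨S, enc, hS⟩ := Circ.Scheme.exists_computes M
  refine ⟨S.circuit, S.circuit_wellFormed, fun w => (hS.eval_circuit w).symm,
    ⟨8 * S.blk + S.out.size + 2, fun n => ?_⟩, ⟨3 * S.blk + S.out.size, fun n => ?_⟩,
    logspaceUniform_circuit S⟩
  · have h1 : Circ.Scheme.leaves n ≤ 2 * (n + 1) := by
      have : (n + 1).size - 1 < (n + 1).size := by
        have : 0 < (n + 1).size := Nat.size_pos.2 (Nat.succ_pos n)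
        omega
      have h2 := Nat.lt_size.1 this
      rw [Circ.Scheme.leaves, ← Nat.sub_add_cancel (show 1 ≤ (n + 1).size by omega), pow_succ]
      omega
    have h2 : (S.circuit n).length ≤ S.blk * (4 * (n + 1)) + S.out.size := by
      rw [S.length_circuit]
      exact Nat.add_le_add_right (Nat.mul_le_mul_left _ (by omega)) _
    refine h2.trans ?_
    set b := S.blk
    set e := S.out.size
    -- Powers of `n` absorb the constant factors only from `n = 2` on; for smaller `n` the additive
    -- term of the bound is enough.
    rcases Nat.lt_or_ge n 2 with hn | hn
    · have : b * (4 * (n + 1)) ≤ b * 8 := Nat.mul_le_mul_left _ (by omega)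
      omega
    · have h3 : 8 * b + e + 1 < 2 ^ (8 * b + e + 1) := Nat.lt_two_pow_self
      have h4 : 2 ^ (8 * b + e + 1) ≤ n ^ (8 * b + e + 1) := Nat.pow_le_pow_left hn _
      have h5 : (8 * b) * n ≤ n ^ (8 * b + e + 1) * n := Nat.mul_le_mul_right _ (by omega)
      rw [← pow_succ] at h5
      have h6 : b * (4 * (n + 1)) = 4 * b * n + 4 * b := by ring
      have h7 : 8 * b * n = 4 * b * n + 4 * b * n := by ring
      rw [h6]
      have h8 : n ^ (8 * b + e + 2) = n ^ (8 * b + e + 1 + 1) := rfl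
      omega
  · refine (S.depth_circuit n).trans ?_
    have h1 := size_succ_le_log n
    have h2 : S.blk * ((n + 1).size + 1) ≤ S.blk * (Nat.log 2 n + 3) :=
      Nat.mul_le_mul_left _ (by omega)
    have h3 : S.blk * (Nat.log 2 n + 3) = S.blk * Nat.log 2 n + 3 * S.blk := by ring
    have h4 : S.blk * Nat.log 2 n ≤ (3 * S.blk + S.out.size) * Nat.log 2 n :=
      Nat.mul_le_mul_right _ (by omega)
    omega

theorem theorem1 (p : ℕ) (hp : 1 < p) : InNC1 (KSPM.AP p) :=
  (KSPM.AP_isRegular hp).inNC1
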